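/- **Proposition 5.2.** Let $k$ be a field and $E=(E^0,E^1,r,s)$ a finite quiver. Let $\overline{E}$ be the inverse quiver (same vertices, all arrows reversed) and let $R=P(\overline{E})$ be its path algebra over $k$: it has the paths of $\overline E$ as $k$-basis, $p_i$ denotes the trivial path at the vertex $i$, and the product of two paths $\alpha\beta$ is their concatenation ($\alpha$ first) if the range of $\alpha$ is the source of $\beta$, and $0$ otherwise. Let $A_E=(a_{ij})_{i,j\in E^0}$ be the adjacency matrix of $E$, where $a_{ij}$ is the number of arrows of $E$ from $i$ to $j$. Let $\mathcal{T}$ be the category of left $R$-modules of finite dimension over $k$, and $\mathrm{fp}(R)$ the category of finitely presented left $R$-modules. For these categories $K_0$ is the abelian group generated by the classes $[M]$ of the objects, with the relations $[M]=[M']+[M'']$ for all short exact sequences $0\to M'\to M\to M''\to 0$ in the category; $K_0(R)$ is $K_0$ of the category of finitely generated projective left $R$-modules. Then: 1. $K_0(\mathcal{T})$ is a free abelian group with basis the classes $[S]$, where $S$ ranges over the isomorphism classes of simple, finite-dimensional left $R$-modules. 2. The canonical map $\iota\colon K_0(R)\to K_0(\mathrm{fp}(R))$ is an isomorphism, and $K_0(\mathrm{fp}(R))$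 is a free abelian group with basis $[Rp_i]$, $i\in E^0$. 3. Every finite-dimensional left $R$-module is finitely presented, and the image of the induced map $K_0(\mathcal{T})\to K_0(\mathrm{fp}(R))$ is the subgroup generated by the columns of the matrix $1-A_E^t$, that is, by the elements $\sum_{j\in E^0}(\delta_{ij}-a_{ij})\,[Rp_j]$ for $i\in E^0$. -/

import Mathlib

open CategoryTheory

universe u v w

noncomputable section

/-! ### The path algebra of a quiver -/

/-- The path algebra of a quiver: the free `k`-module on the set of all paths
(including the trivial path at each vertex). -/
def PathAlgebra (k : Type u) [CommRing k] (V : Type v) [Quiver.{w} V] : Type (max u v w) :=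
  (Σ (a : V) (b : V), Quiver.Path a b) →₀ k

namespace PathAlgebra

variable (k : Type u) [CommRing k] (V : Type v) [Quiver.{w} V]

instance : AddCommGroup (PathAlgebra k V) :=
  inferInstanceAs (AddCommGroup ((Σ (a : V) (b : V), Quiver.Path a b) →₀ k))

instance : Module k (PathAlgebra k V) :=
  inferInstanceAs (Module k ((Σ (a : V) (b : V), Quiver.Path a b) →₀ k))

variable {V}

/-- The basis element of the path algebra given by a path. -/
def ofPath {a b : V} (p : Quiver.Path a b) : PathAlgebra k V :=
  Finsupp.single ⟨a, b, p⟩ 1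

open Classical in
/-- The product of two paths: the concatenation `p q` (first `p`, then `q`) if the range of `p`
is the source of `q`, and zero otherwise. -/
def pathMul (p q : Σ (a : V) (b : V), Quiver.Path a b) : PathAlgebra k V :=
  if h : p.2.1 = q.1 then ofPath k (p.2.2.comp (q.2.2.cast h.symm rfl)) else 0

variable (V)

/-- The bilinear extension of the product of paths. -/
def mulHom : PathAlgebra k V →ₗ[k] PathAlgebra k V →ₗ[k] PathAlgebra k V :=
  Finsupp.linearCombination k fun p => Finsupp.linearCombination k fun q => pathMul k p q

variable {V}

instance : Mul (PathAlgebra k V) := ⟨fun x y => mulHom k V x y⟩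

theorem mul_def (x y : PathAlgebra k V) : x * y = mulHom k V x y := rfl

theorem mulHom_apply_ofPath {a b : V} (p : Quiver.Path a b) : mulHom k V (ofPath k p) =
    Finsupp.linearCombination k fun q => pathMul k ⟨a, b, p⟩ q :=
  (Finsupp.linearCombination_single k 1 _).trans (one_smul k _)

theorem ofPath_mul_ofPath {a b c : V} (p : Quiver.Path a b) (q : Quiver.Path b c) :
    ofPath k p * ofPath k q = ofPath k (p.comp q) := by
  have h1 : mulHom k V (ofPath k p) (ofPath k q) = pathMul k ⟨a, b, p⟩ ⟨b, c, q⟩ := by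
    rw [mulHom_apply_ofPath]
    exact (Finsupp.linearCombination_single k 1 _).trans (one_smul k _)
  rw [mul_def, h1]
  simp [pathMul]

theorem ofPath_mul_ofPath_of_ne {a b c d : V} (h : b ≠ c) (p : Quiver.Path a b)
    (q : Quiver.Path c d) : ofPath k p * ofPath k q = 0 := by
  have h1 : mulHom k V (ofPath k p) (ofPath k q) = pathMul k ⟨a, b, p⟩ ⟨c, d, q⟩ := by
    rw [mulHom_apply_ofPath]
    exact (Finsupp.linearCombination_single k 1 _).trans (one_smul k _)
  rw [mul_def, h1]
  simp [pathMul, h]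

/-- To prove an additive, homogeneous property of all elements it is enough to check paths. -/
theorem induction {P : PathAlgebra k V → Prop} (x : PathAlgebra k V) (zero : P 0)
    (add : ∀ x y, P x → P y → P (x + y)) (smul : ∀ (c : k) x, P x → P (c • x))
    (path : ∀ (a b : V) (p : Quiver.Path a b), P (ofPath k p)) : P x := by
  refine Finsupp.induction_linear (motive := P) x zero add ?_
  rintro ⟨a, b, p⟩ c
  have h := smul c _ (path a b p)
  have h2 : c • ofPath k p = (Finsupp.single ⟨a, b, p⟩ c : PathAlgebra k V) := by
    rw [ofPath]
    exact (Finsupp.smul_single _ _ _).trans (by rw [smul_eq_mul, mul_one])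
  rwa [h2] at h

protected theorem zero_mul (x : PathAlgebra k V) : 0 * x = 0 := by simp [mul_def]

protected theorem mul_zero (x : PathAlgebra k V) : x * 0 = 0 := by simp [mul_def]

protected theorem add_mul (x y z : PathAlgebra k V) : (x + y) * z = x * z + y * z := by
  simp [mul_def]

protected theorem mul_add (x y z : PathAlgebra k V) : x * (y + z) = x * y + x * z := by
  simp [mul_def]

protected theorem smul_mul (c : k) (x y : PathAlgebra k V) : c • x * y = c • (x * y) := by
  simp [mul_def]

protected theorem mul_smul (c : k) (x y : PathAlgebra k V) : x * c • y = c • (x * y) := by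
  simp [mul_def]

protected theorem mul_assoc (x y z : PathAlgebra k V) : x * y * z = x * (y * z) := by
  induction x using PathAlgebra.induction with
  | zero => simp only [PathAlgebra.zero_mul]
  | add x x' h h' => simp only [PathAlgebra.add_mul, h, h']
  | smul c x h => simp only [PathAlgebra.smul_mul, h]
  | path a b p =>
  induction y using PathAlgebra.induction with
  | zero => simp only [PathAlgebra.zero_mul, PathAlgebra.mul_zero]
  | add x x' h h' => simp only [PathAlgebra.add_mul, PathAlgebra.mul_add, h, h']
  | smul c x h => simp only [PathAlgebra.smul_mul, PathAlgebra.mul_smul, h]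
  | path c d q =>
  induction z using PathAlgebra.induction with
  | zero => simp only [PathAlgebra.mul_zero]
  | add x x' h h' => simp only [PathAlgebra.mul_add, h, h']
  | smul c x h => simp only [PathAlgebra.mul_smul, h]
  | path e f r =>
  by_cases hbc : b = c
  · subst hbc
    by_cases hde : d = e
    · subst hde
      simp only [ofPath_mul_ofPath, Quiver.Path.comp_assoc]
    · simp only [ofPath_mul_ofPath, ofPath_mul_ofPath_of_ne k hde, PathAlgebra.mul_zero]
  · by_cases hde : d = e
    · subst hde
      simp only [ofPath_mul_ofPath, ofPath_mul_ofPath_of_ne k hbc, PathAlgebra.zero_mul]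
    · simp only [ofPath_mul_ofPath_of_ne k hbc, ofPath_mul_ofPath_of_ne k hde,
        PathAlgebra.zero_mul, PathAlgebra.mul_zero]

/-- The idempotent `p_i` given by the trivial path at the vertex `i`. -/
def vertex (i : V) : PathAlgebra k V := ofPath k (Quiver.Path.nil : Quiver.Path i i)

theorem vertex_mul_vertex (i : V) : vertex k i * vertex k i = vertex k i := by
  rw [vertex, ofPath_mul_ofPath, Quiver.Path.comp_nil]

variable [Fintype V]

/-- The unit is the sum of all trivial paths. -/
instance : One (PathAlgebra k V) := ⟨∑ i : V, vertex k i⟩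

theorem one_def : (1 : PathAlgebra k V) = ∑ i : V, vertex k i := rfl

protected theorem one_mul (x : PathAlgebra k V) : 1 * x = x := by
  induction x using PathAlgebra.induction with
  | zero => simp only [PathAlgebra.mul_zero]
  | add x x' h h' => simp only [PathAlgebra.mul_add, h, h']
  | smul c x h => simp only [PathAlgebra.mul_smul, h]
  | path a b p =>
  have h1 : (1 : PathAlgebra k V) * ofPath k p = ∑ i : V, vertex k i * ofPath k p := by
    simp only [one_def, mul_def, map_sum, LinearMap.sum_apply]
  rw [h1, Finset.sum_eq_single a]
  · rw [vertex, ofPath_mul_ofPath, Quiver.Path.nil_comp]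
  · intro i _ hi
    exact ofPath_mul_ofPath_of_ne k hi _ _
  · simp

protected theorem mul_one (x : PathAlgebra k V) : x * 1 = x := by
  induction x using PathAlgebra.induction with
  | zero => simp only [PathAlgebra.zero_mul]
  | add x x' h h' => simp only [PathAlgebra.add_mul, h, h']
  | smul c x h => simp only [PathAlgebra.smul_mul, h]
  | path a b p =>
  have h1 : ofPath k p * (1 : PathAlgebra k V) = ∑ i : V, ofPath k p * vertex k i := by
    simp only [one_def, mul_def, map_sum]
  rw [h1, Finset.sum_eq_single b]
  · rw [vertex, ofPath_mul_ofPath, Quiver.Path.comp_nil]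
  · intro i _ hi
    exact ofPath_mul_ofPath_of_ne k hi.symm _ _
  · simp

instance : Ring (PathAlgebra k V) :=
  { (inferInstance : AddCommGroup (PathAlgebra k V)),
    (inferInstance : Mul (PathAlgebra k V)),
    (inferInstance : One (PathAlgebra k V)) with
    left_distrib := PathAlgebra.mul_add k
    right_distrib := PathAlgebra.add_mul k
    zero_mul := PathAlgebra.zero_mul k
    mul_zero := PathAlgebra.mul_zero k
    mul_assoc := PathAlgebra.mul_assoc k
    one_mul := PathAlgebra.one_mul k
    mul_one := PathAlgebra.mul_one k }

instance : Algebra k (PathAlgebra k V) :=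
  Algebra.ofModule (PathAlgebra.smul_mul k) (PathAlgebra.mul_smul k)

end PathAlgebra

/-- The set of vertices of the inverse (opposite) quiver of a finite quiver is finite. -/
instance instFintypeOppositeVertices (V : Type v) [Fintype V] : Fintype Vᵒᵖ :=
  Fintype.ofEquiv V Opposite.equivToOpposite

/-! ### The Grothendieck group of a full subcategory -/

section K0

variable {C : Type u} [Category.{v} C] [Abelian C]

/-- The Grothendieck group `K_0` of the full subcategory of an abelian category cut out by `P`:
the free abelian group on the objects, modulo the relations `[X₂] = [X₁] + [X₃]` for all short
exact sequences `0 → X₁ → X₂ → X₃ → 0` with all three terms in the subcategory. -/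
def K0 (P : ObjectProperty C) : Type u :=
  FreeAbelianGroup P.FullSubcategory ⧸ AddSubgroup.closure
    {x : FreeAbelianGroup P.FullSubcategory |
      ∃ (S : ShortComplex C) (_ : S.ShortExact) (h₁ : P S.X₁) (h₂ : P S.X₂) (h₃ : P S.X₃),
        x = FreeAbelianGroup.of ⟨S.X₂, h₂⟩ -
          (FreeAbelianGroup.of ⟨S.X₁, h₁⟩ + FreeAbelianGroup.of ⟨S.X₃, h₃⟩)}

namespace K0

instance (P : ObjectProperty C) : AddCommGroup (K0 P) :=
  inferInstanceAs (AddCommGroup (FreeAbelianGroup P.FullSubcategory ⧸ AddSubgroup.closure _))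

/-- The class `[X]` of an object. -/
def of {P : ObjectProperty C} (X : C) (hX : P X) : K0 P :=
  QuotientAddGroup.mk (FreeAbelianGroup.of ⟨X, hX⟩)

theorem of_shortExact {P : ObjectProperty C} (S : ShortComplex C) (hS : S.ShortExact)
    (h₁ : P S.X₁) (h₂ : P S.X₂) (h₃ : P S.X₃) :
    (of S.X₂ h₂ : K0 P) = of S.X₁ h₁ + of S.X₃ h₃ := by
  rw [← sub_eq_zero]
  exact (QuotientAddGroup.eq_zero_iff _).2 (AddSubgroup.subset_closure ⟨S, hS, h₁, h₂, h₃, rfl⟩)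

/-- The homomorphism `[X] ↦ [X]` induced by an inclusion of full subcategories. -/
def map {P Q : ObjectProperty C} (h : P ≤ Q) : K0 P →+ K0 Q :=
  QuotientAddGroup.lift _
    (FreeAbelianGroup.lift fun X : P.FullSubcategory => (of X.obj (h _ X.property) : K0 Q)) <| by
    rw [AddSubgroup.closure_le]
    rintro _ ⟨S, hS, h₁, h₂, h₃, rfl⟩
    simp only [SetLike.mem_coe, AddMonoidHom.mem_ker, map_sub, map_add,
      FreeAbelianGroup.lift_apply_of]
    rw [of_shortExact S hS (h _ h₁) (h _ h₂) (h _ h₃), sub_self]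

theorem map_of {P Q : ObjectProperty C} (h : P ≤ Q) (X : C) (hX : P X) :
    map h (of X hX) = of X (h _ hX) :=
  FreeAbelianGroup.lift_apply_of _ _

end K0

end K0

/-- The collection of isomorphism classes of objects satisfying `P`. -/
def IsoClasses {C : Type u} [Category.{v} C] (P : ObjectProperty C) : Type u :=
  Quotient (isIsomorphicSetoid P.FullSubcategory)

/-- The isomorphism class of an object satisfying `P`. -/
def IsoClasses.mk {C : Type u} [Category.{v} C] {P : ObjectProperty C} (X : C) (hX : P X) :
    IsoClasses P :=
  Quotient.mk (isIsomorphicSetoid P.FullSubcategory) ⟨X, hX⟩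

/-! ### Classes of left modules -/

section Modules

variable (k : Type v) [Field k] (R : Type u) [Ring R]

/-- Left `R`-modules of finite dimension over `k`. -/
def finDimModules [Algebra k R] : ObjectProperty (ModuleCat.{u} R) :=
  fun M => Module.Finite k (RestrictScalars k R M)

/-- Simple left `R`-modules of finite dimension over `k`. -/
def simpleFinDimModules [Algebra k R] : ObjectProperty (ModuleCat.{u} R) :=
  fun M => IsSimpleModule R M ∧ finDimModules k R M

/-- Finitely presented left `R`-modules. -/
def fpModules : ObjectProperty (ModuleCat.{u} R) :=
  fun M => Module.FinitePresentation R M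

/-- Finitely generated projective left `R`-modules. As short exact sequences of projective modules
split, `K0 (projModules R)` is the usual group `K_0(R)`. -/
def projModules : ObjectProperty (ModuleCat.{u} R) :=
  fun M => Module.Finite R M ∧ Module.Projective R M

theorem projModules_le_fpModules : projModules R ≤ fpModules R := by
  rintro M ⟨_, _⟩
  exact Module.finitePresentation_of_projective R M

/-- The left module `R e`, for an element `e` of `R`. -/
def leftIdeal (e : R) : ModuleCat.{u} R := ModuleCat.of R (Submodule.span R {e})

theorem leftIdeal_mem_projModules {e : R} (he : e * e = e) : projModules R (leftIdeal R e) := by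
  refine ⟨Module.Finite.span_singleton R e, ?_⟩
  refine Module.Projective.of_split (M := R) (Submodule.subtype (Submodule.span R {e}))
    ((LinearMap.toSpanSingleton R R e).codRestrict (Submodule.span R {e}) fun r =>
      Submodule.smul_mem _ r (Submodule.mem_span_singleton_self e)) ?_
  refine LinearMap.ext fun ⟨x, hx⟩ => Subtype.ext ?_
  obtain ⟨r, rfl⟩ := Submodule.mem_span_singleton.1 hx
  change r * e * e = r * e
  rw [mul_assoc, he]

end Modules

/-- The adjacency matrix of a quiver: the `(i, j)` entry is the number of arrows from `i` to
`j`. -/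
def adjacencyMatrix (V : Type v) [Quiver.{w} V] : Matrix V V ℤ :=
  fun i j => (Nat.card (i ⟶ j) : ℤ)

/-- The path algebra of the inverse quiver. -/
abbrev InversePathAlgebra (k : Type u) [Field k] (V : Type v) [Quiver.{w} V] :
    Type (max u v w) :=
  PathAlgebra k Vᵒᵖ

/-- The class `[R p_i]` in `K_0` of finitely presented modules over the path algebra `R` of the
inverse quiver. -/
def vertexClass (k : Type u) [Field k] {V : Type v} [Quiver.{w} V] [Fintype V] (i : V) :
    K0 (fpModules (InversePathAlgebra k V)) :=
  K0.of (leftIdeal (InversePathAlgebra k V) (PathAlgebra.vertex k (Opposite.op i)))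
    (projModules_le_fpModules _ _
      (leftIdeal_mem_projModules _ (PathAlgebra.vertex_mul_vertex k (Opposite.op i))))

end

/-! Let `R` be the path algebra of a finite quiver `Q` (at the end, `Q` is the inverse quiver). The
coefficient of the trivial path at `i` is an augmentation `ε_i : R → k`, and Fox calculus gives `p_i
x = ε_i(x) p_i + ∑ e (∂_e x)`, summed over the arrows `e` out of `i` (`vertex_mul_eq`).

Generators. A weak algorithm, with Fox derivatives used to lower degrees, shows that finitely
generated submodules of `R^n` are finite direct sums of modules `R p_i`
(`exists_linearEquiv_pi_span_vertex`). Hence a finitely presented module has a two-term resolution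
by such sums, and the classes `[R p_i]` generate both `K_0(R)` and `K_0(fp(R))`.

Independence. The right simple module at `i` is resolved by `⨁ p_j R → p_i R`, the sum being over
the arrows `i ⟶ j`. Tensoring with `M` gives `arrowsMap : ⨁ p_j M → p_i M`. For finitely presented
`M` its kernel and cokernel are finite-dimensional even when the spaces `p_j M` are not. By the
snake lemma the Euler characteristic `χ_i(M) = dim coker - dim ker` is additive, and `χ_i(R p_l) =
δ_il`. So the `[R p_i]` form a basis of `K_0(fp(R))` with coordinate functions `χ_i`, and `K_0(R) →
K_0(fp(R))` is bijective.

Image of the finite-dimensional modules. These are finitely presented since `R` is a finitely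
generated algebra. If `M` is finite-dimensional, `χ_i(M)` is the difference of the dimensions of the
two terms, so `[M] = ∑ (dim p_l M) c_l`, where `c_l` is the `l`-th column of the identity minus the
adjacency matrix of `Q`. The simple module at `l` has class exactly `c_l`.

Simple modules. Composition series show that simple classes generate `K_0` of the finite-dimensional
modules. By the density theorem some `r` acts as the identity on one of finitely many given simple
modules and as zero on the others. The multiplicity of the eigenvalue `1` of `r` is additive and
isolates one coefficient of a linear relation (`linearIndependent_simpleClass`). -/

noncomputable section

/-! ### Augmentations and Fox derivatives. -/

namespace PathAlgebra

variable (k : Type u) [CommRing k] {Q : Type v} [Quiver.{w} Q]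

/-- The coefficient of the trivial path at the vertex `i`. -/
def nilCoeff (i : Q) : PathAlgebra k Q →ₗ[k] k :=
  Finsupp.lapply (⟨i, i, Quiver.Path.nil⟩ : Σ (a : Q) (b : Q), Quiver.Path a b)

theorem nilCoeff_vertex_self (i : Q) : nilCoeff k i (vertex k i) = 1 :=
  Finsupp.single_eq_same

theorem nilCoeff_ofPath_of_source_ne {i a b : Q} (h : a ≠ i) (p : Quiver.Path a b) :
    nilCoeff k i (ofPath k p) = 0 :=
  Finsupp.single_eq_of_ne fun h' => h (congrArg Sigma.fst h').symm

theorem nilCoeff_vertex_of_ne {i j : Q} (h : j ≠ i) : nilCoeff k i (vertex k j) = 0 :=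
  nilCoeff_ofPath_of_source_ne k h _

theorem nilCoeff_ofPath_cons (i : Q) {a b c : Q} (p : Quiver.Path a b) (e : b ⟶ c) :
    nilCoeff k i (ofPath k (p.cons e)) = 0 := by
  refine Finsupp.single_eq_of_ne fun h' => ?_
  obtain rfl : i = a := congrArg Sigma.fst h'
  simp only [Sigma.mk.injEq, heq_eq_eq, true_and] at h'
  obtain ⟨rfl, h'⟩ := h'
  exact Quiver.Path.nil_ne_cons _ _ (eq_of_heq h')

/-- A concatenation of paths is trivial only if both factors are. -/
theorem nilCoeff_mul (i : Q) (x y : PathAlgebra k Q) :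
    nilCoeff k i (x * y) = nilCoeff k i x * nilCoeff k i y := by
  induction x using PathAlgebra.induction with
  | zero => simp only [PathAlgebra.zero_mul, map_zero, zero_mul]
  | add x x' h h' => simp only [PathAlgebra.add_mul, map_add, h, h', add_mul]
  | smul c x h => simp only [PathAlgebra.smul_mul, map_smul, h, smul_eq_mul, mul_assoc]
  | path a b p =>
  induction y using PathAlgebra.induction with
  | zero => simp only [PathAlgebra.mul_zero, map_zero, mul_zero]
  | add x x' h h' => simp only [PathAlgebra.mul_add, map_add, h, h', mul_add]
  | smul c x h => simp only [PathAlgebra.mul_smul, map_smul, h, smul_eq_mul, mul_left_comm]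
  | path c d q =>
  by_cases hbc : b = c
  · subst hbc
    rw [ofPath_mul_ofPath]
    cases q with
    | nil =>
      rw [Quiver.Path.comp_nil]
      cases p with
      | nil =>
        by_cases hi : a = i
        · subst hi
          exact (nilCoeff_vertex_self k a).trans (by
            rw [show ofPath k (Quiver.Path.nil : Quiver.Path a a) = vertex k a from rfl,
              nilCoeff_vertex_self, one_mul])
        · simp only [nilCoeff_ofPath_of_source_ne k hi, zero_mul]
      | cons p e => simp only [nilCoeff_ofPath_cons, zero_mul]
    | cons q e => simp only [Quiver.Path.comp_cons, nilCoeff_ofPath_cons, mul_zero]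
  · rw [ofPath_mul_ofPath_of_ne k hbc, map_zero]
    cases p with
    | nil =>
      by_cases hi : a = i
      · subst hi
        rw [nilCoeff_ofPath_of_source_ne k (Ne.symm hbc), mul_zero]
      · rw [nilCoeff_ofPath_of_source_ne k hi, zero_mul]
    | cons p e => rw [nilCoeff_ofPath_cons, zero_mul]

theorem ofPath_mul_vertex {a b : Q} (p : Quiver.Path a b) :
    ofPath k p * vertex k b = ofPath k p := by
  rw [vertex, ofPath_mul_ofPath, Quiver.Path.comp_nil]

theorem vertex_mul_ofPath {a b : Q} (p : Quiver.Path a b) :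
    vertex k a * ofPath k p = ofPath k p := by
  rw [vertex, ofPath_mul_ofPath, Quiver.Path.nil_comp]

theorem vertex_mul_ofPath_of_ne {i a b : Q} (h : i ≠ a) (p : Quiver.Path a b) :
    vertex k i * ofPath k p = 0 :=
  ofPath_mul_ofPath_of_ne k h _ _

theorem vertex_mul_vertex_of_ne {i j : Q} (h : i ≠ j) : vertex k i * vertex k j = 0 :=
  ofPath_mul_ofPath_of_ne k h _ _

/-- The element of the path algebra given by an arrow. -/
def arrow {a b : Q} (e : a ⟶ b) : PathAlgebra k Q := ofPath k e.toPath

theorem ofPath_mul_arrow {a b c : Q} (p : Quiver.Path a b) (e : b ⟶ c) :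
    ofPath k p * arrow k e = ofPath k (p.cons e) :=
  ofPath_mul_ofPath k _ _

theorem vertex_mul_arrow {a b : Q} (e : a ⟶ b) : vertex k a * arrow k e = arrow k e :=
  vertex_mul_ofPath k _

theorem arrow_mul_vertex {a b : Q} (e : a ⟶ b) : arrow k e * vertex k b = arrow k e :=
  ofPath_mul_vertex k _

theorem nilCoeff_arrow (i : Q) {a b : Q} (e : a ⟶ b) : nilCoeff k i (arrow k e) = 0 :=
  nilCoeff_ofPath_cons k i _ _

open Classical in
/-- The trivial path at the target of `e` if the arrows `e` and `f` agree, and zero otherwise. -/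
def arrowDelta {i j a b : Q} (e : i ⟶ j) (f : a ⟶ b) : PathAlgebra k Q :=
  if (⟨i, j, e⟩ : Σ (a : Q) (b : Q), (a ⟶ b)) = ⟨a, b, f⟩ then vertex k j else 0

theorem arrowDelta_self {i j : Q} (e : i ⟶ j) : arrowDelta k e e = vertex k j := if_pos rfl

theorem arrowDelta_of_ne {i j a b : Q} {e : i ⟶ j} {f : a ⟶ b}
    (h : (⟨i, j, e⟩ : Σ (a : Q) (b : Q), (a ⟶ b)) ≠ ⟨a, b, f⟩) : arrowDelta k e f = 0 := if_neg h

theorem arrowDelta_mul_vertex {i j a b : Q} (e : i ⟶ j) (f : a ⟶ b) :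
    arrowDelta k e f * vertex k b = arrowDelta k e f := by
  by_cases h : (⟨i, j, e⟩ : Σ (a : Q) (b : Q), (a ⟶ b)) = ⟨a, b, f⟩
  · cases h
    rw [arrowDelta_self, vertex_mul_vertex]
  · rw [arrowDelta_of_ne k h, PathAlgebra.zero_mul]

/-- The Fox derivative of a path with respect to an arrow: the path with its first arrow `e`
removed, and zero if it does not start with `e`. -/
def stripPath {i j : Q} (e : i ⟶ j) {a : Q} : ∀ {b : Q}, Quiver.Path a b → PathAlgebra k Q
  | _, .nil => 0
  -- Paths grow at their end, so the first arrow lies in `p` unless `p` is trivial; the second term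
  -- covers that case, in which `f` is the first arrow.
  | _, .cons p f => stripPath e p * arrow k f + nilCoeff k i (ofPath k p) • arrowDelta k e f

theorem stripPath_mul_vertex {i j : Q} (e : i ⟶ j) {a b : Q} (p : Quiver.Path a b) :
    stripPath k e p * vertex k b = stripPath k e p := by
  cases p with
  | nil => exact PathAlgebra.zero_mul k _
  | cons p f =>
    simp only [stripPath, PathAlgebra.add_mul, PathAlgebra.smul_mul, PathAlgebra.mul_assoc,
      arrow_mul_vertex, arrowDelta_mul_vertex]

theorem stripPath_of_source_ne {i j : Q} (e : i ⟶ j) {a b : Q} (h : a ≠ i)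
    (p : Quiver.Path a b) : stripPath k e p = 0 := by
  induction p with
  | nil => rfl
  | cons p f ih =>
    simp only [stripPath, ih, PathAlgebra.zero_mul, nilCoeff_ofPath_of_source_ne k h, zero_smul,
      add_zero]

/-- The left Fox derivative with respect to the arrow `e`. -/
def foxDeriv {i j : Q} (e : i ⟶ j) : PathAlgebra k Q →ₗ[k] PathAlgebra k Q :=
  Finsupp.linearCombination k fun p : Σ (a : Q) (b : Q), Quiver.Path a b => stripPath k e p.2.2

theorem foxDeriv_ofPath {i j : Q} (e : i ⟶ j) {a b : Q} (p : Quiver.Path a b) :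
    foxDeriv k e (ofPath k p) = stripPath k e p :=
  (Finsupp.linearCombination_single k 1 _).trans (one_smul k _)

theorem foxDeriv_vertex {i j : Q} (e : i ⟶ j) (a : Q) : foxDeriv k e (vertex k a) = 0 :=
  foxDeriv_ofPath k e _

theorem stripPath_comp {i j : Q} (e : i ⟶ j) {a b c : Q} (p : Quiver.Path a b)
    (q : Quiver.Path b c) : stripPath k e (p.comp q) =
      stripPath k e p * ofPath k q + nilCoeff k i (ofPath k p) • stripPath k e q := by
  induction q with
  | nil =>
    simp only [Quiver.Path.comp_nil, stripPath, smul_zero, add_zero]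
    exact (stripPath_mul_vertex k e p).symm
  | cons q f ih =>
    simp only [Quiver.Path.comp_cons, stripPath, ih, ← ofPath_mul_ofPath, nilCoeff_mul,
      ← ofPath_mul_arrow, PathAlgebra.add_mul, PathAlgebra.smul_mul, PathAlgebra.mul_assoc,
      smul_add, mul_smul, add_assoc]

/-- The first arrow of a product of paths belongs to the left factor unless that factor is trivial,
so the derivative obeys a Leibniz rule twisted by the augmentation. -/
theorem foxDeriv_mul {i j : Q} (e : i ⟶ j) (x y : PathAlgebra k Q) :
    foxDeriv k e (x * y) = foxDeriv k e x * y + nilCoeff k i x • foxDeriv k e y := by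
  induction x using PathAlgebra.induction with
  | zero => simp only [PathAlgebra.zero_mul, map_zero, zero_smul, add_zero]
  | add x x' h h' =>
    simp only [PathAlgebra.add_mul, map_add, h, h', add_smul]
    abel
  | smul c x h => simp only [PathAlgebra.smul_mul, map_smul, h, smul_eq_mul, mul_smul, smul_add]
  | path a b p =>
  induction y using PathAlgebra.induction with
  | zero => simp only [PathAlgebra.mul_zero, map_zero, smul_zero, add_zero]
  | add x x' h h' =>
    simp only [PathAlgebra.mul_add, map_add, h, h', smul_add]
    abel
  | smul c x h => simp only [PathAlgebra.mul_smul, map_smul, h, smul_add, smul_comm c]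
  | path c d q =>
  by_cases hbc : b = c
  · subst hbc
    simp only [ofPath_mul_ofPath, foxDeriv_ofPath, stripPath_comp]
  · rw [ofPath_mul_ofPath_of_ne k hbc, map_zero, foxDeriv_ofPath, foxDeriv_ofPath,
      ← stripPath_mul_vertex, PathAlgebra.mul_assoc, vertex_mul_ofPath_of_ne k hbc,
      PathAlgebra.mul_zero, zero_add]
    cases p with
    | nil =>
      by_cases hi : a = i
      · subst hi
        rw [stripPath_of_source_ne k e (Ne.symm hbc), smul_zero]
      · rw [nilCoeff_ofPath_of_source_ne k hi, zero_smul]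
    | cons p f => rw [nilCoeff_ofPath_cons, zero_smul]

theorem foxDeriv_arrow_mul {i j a b : Q} (e : i ⟶ j) (f : a ⟶ b) (x : PathAlgebra k Q) :
    foxDeriv k e (arrow k f * x) = arrowDelta k e f * x := by
  rw [foxDeriv_mul, nilCoeff_arrow, zero_smul, add_zero]
  congr 1
  refine (foxDeriv_ofPath k e _).trans ?_
  change stripPath k e (Quiver.Path.cons Quiver.Path.nil f) = _
  simp only [stripPath, PathAlgebra.zero_mul, zero_add]
  by_cases hi : a = i
  · subst hi
    exact (congrArg (· • _) (nilCoeff_vertex_self k a)).trans (one_smul k _)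
  · rw [nilCoeff_ofPath_of_source_ne k hi, zero_smul, arrowDelta_of_ne]
    exact fun h => hi (congrArg Sigma.fst h).symm

theorem foxDeriv_mul_vertex {i j : Q} (e : i ⟶ j) (a : Q) {x : PathAlgebra k Q}
    (hx : x * vertex k a = x) : foxDeriv k e x * vertex k a = foxDeriv k e x := by
  conv_rhs => rw [← hx, foxDeriv_mul, foxDeriv_vertex, smul_zero, add_zero]

theorem vertex_mul_foxDeriv {i j : Q} (e : i ⟶ j) (x : PathAlgebra k Q) :
    vertex k j * foxDeriv k e x = foxDeriv k e x := by
  induction x using PathAlgebra.induction with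
  | zero => simp only [PathAlgebra.mul_zero, map_zero]
  | add x x' h h' => simp only [PathAlgebra.mul_add, map_add, h, h']
  | smul c x h => simp only [PathAlgebra.mul_smul, map_smul, h]
  | path a b p =>
  rw [foxDeriv_ofPath]
  induction p with
  | nil => exact PathAlgebra.mul_zero k _
  | @cons c d p f ih =>
    simp only [stripPath, PathAlgebra.mul_add, PathAlgebra.mul_smul, ← PathAlgebra.mul_assoc, ih]
    congr 2
    by_cases h : (⟨i, j, e⟩ : Σ (a : Q) (b : Q), (a ⟶ b)) = ⟨c, d, f⟩
    · cases h
      rw [arrowDelta_self, vertex_mul_vertex]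
    · rw [arrowDelta_of_ne k h, PathAlgebra.mul_zero]

/-- The arrows with source `i`. -/
abbrev ArrowsFrom (i : Q) : Type (max v w) := Σ j : Q, (i ⟶ j)

section Finite

variable [Fintype Q] [∀ i j : Q, Finite (i ⟶ j)]

instance instFintypeArrowsFrom (i : Q) : Fintype (ArrowsFrom i) := Fintype.ofFinite _

theorem sum_arrow_mul_arrowDelta (i : Q) {a b : Q} (f : a ⟶ b) :
    ∑ e : ArrowsFrom i, arrow k e.2 * arrowDelta k e.2 f = vertex k i * arrow k f := by
  by_cases hi : i = a
  · subst hi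
    rw [Finset.sum_eq_single ⟨b, f⟩]
    · rw [arrowDelta_self, arrow_mul_vertex, vertex_mul_arrow]
    · rintro ⟨j, e⟩ - he
      rw [arrowDelta_of_ne, mul_zero]
      intro h
      cases h
      exact he rfl
    · simp
  · rw [arrow, vertex_mul_ofPath_of_ne k hi]
    refine Finset.sum_eq_zero fun e _ => ?_
    rw [arrowDelta_of_ne, mul_zero]
    exact fun h => hi (congrArg Sigma.fst h)

/-- The fundamental formula of Fox calculus. -/
theorem vertex_mul_eq (i : Q) (x : PathAlgebra k Q) : vertex k i * x =
    nilCoeff k i x • vertex k i + ∑ e : ArrowsFrom i, arrow k e.2 * foxDeriv k e.2 x := by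
  induction x using PathAlgebra.induction with
  | zero => simp only [mul_zero, map_zero, zero_smul, Finset.sum_const_zero, add_zero]
  | add x x' h h' =>
    simp only [mul_add, map_add, h, h', add_smul, Finset.sum_add_distrib]
    abel
  | smul c x h =>
    simp only [PathAlgebra.mul_smul, map_smul, h, smul_eq_mul, mul_smul, smul_add, Finset.smul_sum]
  | path a b p =>
  simp only [foxDeriv_ofPath]
  induction p with
  | nil =>
    simp only [stripPath, mul_zero, Finset.sum_const_zero, add_zero]
    change vertex k i * vertex k a = nilCoeff k i (vertex k a) • vertex k i
    by_cases hi : i = a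
    · subst hi
      rw [vertex_mul_vertex, nilCoeff_vertex_self, one_smul]
    · rw [vertex_mul_vertex_of_ne k hi, nilCoeff_vertex_of_ne k (Ne.symm hi), zero_smul]
  | cons p f ih =>
    rw [← ofPath_mul_arrow, ← mul_assoc, ih, ofPath_mul_arrow, nilCoeff_ofPath_cons, zero_smul,
      zero_add]
    simp only [stripPath, mul_add, Finset.sum_add_distrib, PathAlgebra.mul_smul, add_mul,
      PathAlgebra.smul_mul, ← Finset.smul_sum, sum_arrow_mul_arrowDelta, Finset.sum_mul, mul_assoc]
    rw [add_comm]

theorem eq_sum_nilCoeff_add (x : PathAlgebra k Q) : x = ∑ i : Q, (nilCoeff k i x • vertex k i +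
    ∑ e : ArrowsFrom i, arrow k e.2 * foxDeriv k e.2 x) := by
  conv_lhs => rw [← one_mul x, one_def, Finset.sum_mul]
  exact Finset.sum_congr rfl fun i _ => vertex_mul_eq k i x

end Finite

/-! ### The filtration by path length. -/

/-- The elements of the path algebra supported on paths of length less than `n`. -/
def filtration (Q : Type v) [Quiver.{w} Q] (n : ℕ) : Submodule k (PathAlgebra k Q) :=
  Submodule.span k {x | ∃ (a b : Q) (p : Quiver.Path a b), p.length < n ∧ x = ofPath k p}

variable {k}

theorem ofPath_mem_filtration {n : ℕ} {a b : Q} {p : Quiver.Path a b} (h : p.length < n) :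
    ofPath k p ∈ filtration k Q n :=
  Submodule.subset_span ⟨a, b, p, h, rfl⟩

theorem filtration_mono {m n : ℕ} (h : m ≤ n) : filtration k Q m ≤ filtration k Q n :=
  Submodule.span_mono fun _ ⟨a, b, p, hp, hx⟩ => ⟨a, b, p, hp.trans_le h, hx⟩

theorem filtration_zero : filtration k Q 0 = ⊥ := by
  rw [filtration, Submodule.span_eq_bot]
  rintro _ ⟨a, b, p, hp, -⟩
  exact absurd hp (Nat.not_lt_zero _)

theorem exists_mem_filtration (x : PathAlgebra k Q) : ∃ n, x ∈ filtration k Q n := by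
  induction x using PathAlgebra.induction with
  | zero => exact ⟨0, zero_mem _⟩
  | add x y h h' =>
    obtain ⟨m, hm⟩ := h
    obtain ⟨n, hn⟩ := h'
    exact ⟨max m n, add_mem (filtration_mono (le_max_left _ _) hm)
      (filtration_mono (le_max_right _ _) hn)⟩
  | smul c x h => exact h.imp fun n hn => Submodule.smul_mem _ c hn
  | path a b p => exact ⟨p.length + 1, ofPath_mem_filtration p.length.lt_succ_self⟩

theorem mul_ofPath_mem_filtration {n : ℕ} {x : PathAlgebra k Q} (hx : x ∈ filtration k Q n)
    {a b : Q} (q : Quiver.Path a b) : x * ofPath k q ∈ filtration k Q (n + q.length) := by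
  induction hx using Submodule.span_induction with
  | zero => rw [PathAlgebra.zero_mul]; exact zero_mem _
  | add x y _ _ h h' => rw [PathAlgebra.add_mul]; exact add_mem h h'
  | smul c x _ h => rw [PathAlgebra.smul_mul]; exact Submodule.smul_mem _ c h
  | mem x h =>
    obtain ⟨c, d, p, hp, rfl⟩ := h
    by_cases hd : d = a
    · subst hd
      rw [ofPath_mul_ofPath]
      exact ofPath_mem_filtration (by rw [Quiver.Path.length_comp]; lia)
    · rw [ofPath_mul_ofPath_of_ne k hd]
      exact zero_mem _

theorem ofPath_mul_mem_filtration {n : ℕ} {x : PathAlgebra k Q} (hx : x ∈ filtration k Q n)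
    {a b : Q} (q : Quiver.Path a b) : ofPath k q * x ∈ filtration k Q (n + q.length) := by
  induction hx using Submodule.span_induction with
  | zero => rw [PathAlgebra.mul_zero]; exact zero_mem _
  | add x y _ _ h h' => rw [PathAlgebra.mul_add]; exact add_mem h h'
  | smul c x _ h => rw [PathAlgebra.mul_smul]; exact Submodule.smul_mem _ c h
  | mem x h =>
    obtain ⟨c, d, p, hp, rfl⟩ := h
    by_cases hd : b = c
    · subst hd
      rw [ofPath_mul_ofPath]
      exact ofPath_mem_filtration (by rw [Quiver.Path.length_comp]; lia)
    · rw [ofPath_mul_ofPath_of_ne k hd]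
      exact zero_mem _

theorem vertex_mul_mem_filtration {n : ℕ} {x : PathAlgebra k Q} (hx : x ∈ filtration k Q n)
    (i : Q) : vertex k i * x ∈ filtration k Q n :=
  ofPath_mul_mem_filtration hx (Quiver.Path.nil : Quiver.Path i i)

theorem vertex_mem_filtration (i : Q) (n : ℕ) : vertex k i ∈ filtration k Q (n + 1) :=
  ofPath_mem_filtration n.succ_pos

theorem stripPath_mem_filtration {i j : Q} (e : i ⟶ j) {a b : Q} (p : Quiver.Path a b) :
    stripPath k e p ∈ filtration k Q p.length := by
  induction p with
  | nil => exact zero_mem _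
  | @cons c d p f ih =>
    refine add_mem (mul_ofPath_mem_filtration ih f.toPath) (Submodule.smul_mem _ _ ?_)
    by_cases h : (⟨i, j, e⟩ : Σ (a : Q) (b : Q), (a ⟶ b)) = ⟨c, d, f⟩
    · cases h
      rw [arrowDelta_self]
      exact vertex_mem_filtration _ _
    · rw [arrowDelta_of_ne k h]
      exact zero_mem _

theorem foxDeriv_mem_filtration {i j : Q} (e : i ⟶ j) {n : ℕ} {x : PathAlgebra k Q}
    (hx : x ∈ filtration k Q (n + 1)) : foxDeriv k e x ∈ filtration k Q n := by
  induction hx using Submodule.span_induction with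
  | zero => rw [map_zero]; exact zero_mem _
  | add x y _ _ h h' => rw [map_add]; exact add_mem h h'
  | smul c x _ h => rw [map_smul]; exact Submodule.smul_mem _ c h
  | mem x h =>
    obtain ⟨c, d, p, hp, rfl⟩ := h
    rw [foxDeriv_ofPath]
    exact filtration_mono (Nat.le_of_lt_succ hp) (stripPath_mem_filtration e p)

variable [Fintype Q] [∀ i j : Q, Finite (i ⟶ j)]

/-- The Fox formula rebuilds `x` from its derivatives by adding one arrow in front. In
contrapositive form, some derivative retains part of the top degree of `x`, which drives the weak
algorithm. -/
theorem mem_filtration_succ {n : ℕ} {x : PathAlgebra k Q}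
    (h : ∀ (i j : Q) (e : i ⟶ j), foxDeriv k e x ∈ filtration k Q n) :
    x ∈ filtration k Q (n + 1) := by
  rw [eq_sum_nilCoeff_add k x]
  refine sum_mem fun i _ => add_mem (Submodule.smul_mem _ _ (vertex_mem_filtration _ _))
    (sum_mem fun e _ => ?_)
  exact ofPath_mul_mem_filtration (h i e.1 e.2) e.2.toPath

/-- All derivatives of `x` vanish, so `x` is a combination of trivial paths, of which right
multiplication by `p_a` keeps only one. -/
theorem eq_smul_vertex_of_mem_filtration_one {x : PathAlgebra k Q} {a : Q}
    (hx : x ∈ filtration k Q 1) (ha : x * vertex k a = x) : x = nilCoeff k a x • vertex k a := by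
  have h0 : ∀ (i j : Q) (e : i ⟶ j), foxDeriv k e x = 0 := fun i j e => by
    have := foxDeriv_mem_filtration e hx
    rwa [filtration_zero, Submodule.mem_bot] at this
  have h1 : x = ∑ i : Q, nilCoeff k i x • vertex k i := by
    conv_lhs => rw [eq_sum_nilCoeff_add k x]
    simp only [h0, mul_zero, Finset.sum_const_zero, add_zero]
  conv_lhs => rw [← ha, h1, Finset.sum_mul]
  rw [Finset.sum_eq_single a]
  · rw [PathAlgebra.smul_mul, vertex_mul_vertex]
  · intro i _ hi
    rw [PathAlgebra.smul_mul, vertex_mul_vertex_of_ne k hi, smul_zero]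
  · simp

end PathAlgebra

/-! ### The weak algorithm and submodules of free modules. -/

namespace PathAlgebra

section WeakAlgorithm

variable {k : Type u} [Field k] {Q : Type v} [Quiver.{w} Q] [Fintype Q]
  {ι : Type*} {C : Type*} [Fintype C]

/-- A coefficient that is a nonzero multiple of the idempotent fixing `x c₀` can be divided out,
which isolates `x c₀`. -/
theorem add_sum_smul_mem_of_unit_coeff {v : C → Q} {x : C → ι → PathAlgebra k Q}
    (hv : ∀ c, vertex k (v c) • x c = x c) {d : ℕ} {r : C → PathAlgebra k Q}
    (hsum : ∀ t, ∑ c, r c * x c t ∈ filtration k Q d) {c₀ : C} {l : k} (hl : l ≠ 0)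
    (hc₀ : r c₀ = l • vertex k (v c₀)) :
    ∃ s : C → PathAlgebra k Q, s c₀ = 0 ∧
      ∀ t, x c₀ t + ∑ c, s c * x c t ∈ filtration k Q d := by
  classical
  refine ⟨Function.update (fun c => l⁻¹ • r c) c₀ 0, Function.update_self .., fun t => ?_⟩
  have h1 : x c₀ t = l⁻¹ • (r c₀ * x c₀ t) := by
    rw [hc₀, PathAlgebra.smul_mul, smul_smul, inv_mul_cancel₀ hl, one_smul]
    exact (congrFun (hv c₀) t).symm
  have h2 : x c₀ t + ∑ c, Function.update (fun c => l⁻¹ • r c) c₀ 0 c * x c t =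
      l⁻¹ • ∑ c, r c * x c t := by
    rw [← Finset.add_sum_erase _ _ (Finset.mem_univ c₀),
      ← Finset.add_sum_erase (a := c₀) _ (fun c => r c * x c t) (Finset.mem_univ c₀), smul_add,
      ← h1, Function.update_self, zero_mul, zero_add, Finset.smul_sum]
    congr 1
    refine Finset.sum_congr rfl fun c hc => ?_
    rw [Function.update_of_ne (Finset.ne_of_mem_erase hc), PathAlgebra.smul_mul]
  rw [h2]
  exact Submodule.smul_mem _ _ (hsum t)

theorem mem_span_vertex_iff {i : Q} {x : PathAlgebra k Q} :
    x ∈ Submodule.span (PathAlgebra k Q) {vertex k i} ↔ x * vertex k i = x := by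
  rw [Submodule.mem_span_singleton]
  refine ⟨?_, fun h => ⟨x, h⟩⟩
  rintro ⟨a, rfl⟩
  rw [smul_eq_mul, mul_assoc, vertex_mul_vertex]

/-- Since `p_{v c}` fixes `x c`, only coefficients in `R p_{v c}` matter; independence over these
makes the sum of the maps `R p_{v c} → R x_c` injective. -/
theorem exists_linearEquiv_pi_of_independent {v : C → Q} {x : C → ι → PathAlgebra k Q}
    (hv : ∀ c, vertex k (v c) • x c = x c)
    (h : ∀ r : C → PathAlgebra k Q, (∀ c, r c * vertex k (v c) = r c) → ∑ c, r c • x c = 0 →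
      r = 0) :
    Nonempty (Submodule.span (PathAlgebra k Q) (Set.range x) ≃ₗ[PathAlgebra k Q]
      ∀ c, Submodule.span (PathAlgebra k Q) {vertex k (v c)}) := by
  classical
  let f : (∀ c, Submodule.span (PathAlgebra k Q) {vertex k (v c)}) →ₗ[PathAlgebra k Q]
      (ι → PathAlgebra k Q) :=
    ∑ c, (LinearMap.toSpanSingleton (PathAlgebra k Q) _ (x c)) ∘ₗ
      (Submodule.subtype _ ∘ₗ LinearMap.proj c)
  have hf : ∀ r, f r = ∑ c, (r c : PathAlgebra k Q) • x c := fun r => by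
    simp [f, LinearMap.sum_apply]
  have hinj : Function.Injective f := by
    refine (injective_iff_map_eq_zero f).2 fun r hr => ?_
    rw [hf] at hr
    have := h (fun c => r c) (fun c => mem_span_vertex_iff.1 (r c).2) hr
    exact funext fun c => Subtype.ext (congrFun this c)
  have hrange : LinearMap.range f = Submodule.span (PathAlgebra k Q) (Set.range x) := by
    refine le_antisymm ?_ (Submodule.span_le.2 ?_)
    · rintro _ ⟨r, rfl⟩
      rw [hf]
      exact sum_mem fun c _ => Submodule.smul_mem _ _ (Submodule.subset_span ⟨c, rfl⟩)
    · rintro _ ⟨c, rfl⟩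
      refine ⟨Pi.single c ⟨vertex k (v c), Submodule.mem_span_singleton_self _⟩, ?_⟩
      rw [hf, Finset.sum_eq_single c]
      · rw [Pi.single_eq_same]
        exact hv c
      · intro c' _ hc'
        rw [Pi.single_eq_of_ne hc']
        exact zero_smul _ _
      · simp
  exact ⟨((LinearEquiv.ofInjective f hinj).trans (LinearEquiv.ofEq _ _ hrange)).symm⟩

variable [∀ i j : Q, Finite (i ⟶ j)]

/-- In terms of degrees: `x c` has degree at most `e c`, and `r c` at most `d - e c` with equality
for some `c`, yet `∑ r c * x c` has degree below `d`. Differentiating the coefficients lowers `d`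
until one of them becomes a nonzero scalar times an idempotent; then that generator can be reduced
modulo the others. Truncated subtraction forces `r c = 0` when `e c > d`. -/
theorem exists_add_sum_smul_mem_filtration {v : C → Q} {x : C → ι → PathAlgebra k Q} {e : C → ℕ}
    (hv : ∀ c, vertex k (v c) • x c = x c) (hx : ∀ c t, x c t ∈ filtration k Q (e c + 1)) (d : ℕ)
    (r : C → PathAlgebra k Q) (hr : ∀ c, r c * vertex k (v c) = r c)
    (hrd : ∀ c, r c ∈ filtration k Q (d + 1 - e c)) (hrd' : ∃ c, r c ∉ filtration k Q (d - e c))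
    (hsum : ∀ t, ∑ c, r c * x c t ∈ filtration k Q d) :
    ∃ (c₀ : C) (s : C → PathAlgebra k Q), s c₀ = 0 ∧
      ∀ t, x c₀ t + ∑ c, s c * x c t ∈ filtration k Q (e c₀) := by
  induction d generalizing r with
  | zero =>
    obtain ⟨c₀, hc₀⟩ := hrd'
    rw [Nat.zero_sub, filtration_zero, Submodule.mem_bot] at hc₀
    have he : e c₀ = 0 := by
      by_contra he
      have := hrd c₀
      rw [show 0 + 1 - e c₀ = 0 by lia, filtration_zero, Submodule.mem_bot] at this
      exact hc₀ this
    have h1 := eq_smul_vertex_of_mem_filtration_one (by simpa [he] using hrd c₀) (hr c₀)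
    refine ⟨c₀, ?_⟩
    rw [he]
    exact add_sum_smul_mem_of_unit_coeff hv hsum (fun h => hc₀ (by rw [h1, h, zero_smul])) h1
  | succ d ih =>
    by_cases hd : ∃ c, e c = d + 1 ∧ r c ≠ 0
    · obtain ⟨c₀, he, hc₀⟩ := hd
      have h1 := eq_smul_vertex_of_mem_filtration_one (by simpa [he] using hrd c₀) (hr c₀)
      refine ⟨c₀, ?_⟩
      rw [he]
      exact add_sum_smul_mem_of_unit_coeff hv hsum (fun h => hc₀ (by rw [h1, h, zero_smul])) h1
    · have hd' : ∀ c, d < e c → r c = 0 := by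
        intro c hc
        by_contra h0
        have he : d + 1 ≠ e c := fun he => hd ⟨c, he.symm, h0⟩
        have := hrd c
        rw [show d + 1 + 1 - e c = 0 by lia, filtration_zero, Submodule.mem_bot] at this
        exact h0 this
      obtain ⟨c₁, hc₁⟩ := hrd'
      have he₁ : e c₁ ≤ d := by
        by_contra h
        exact hc₁ (by rw [hd' c₁ (by lia)]; exact zero_mem _)
      have hf : ∃ (i j : Q) (f : i ⟶ j), foxDeriv k f (r c₁) ∉ filtration k Q (d - e c₁) := by
        by_contra! h
        have := mem_filtration_succ h
        rw [show d - e c₁ + 1 = d + 1 - e c₁ by lia] at this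
        exact hc₁ this
      obtain ⟨i, j, f, hf⟩ := hf
      refine ih (fun c => foxDeriv k f (r c)) (fun c => foxDeriv_mul_vertex k f _ (hr c))
        (fun c => ?_) ⟨c₁, hf⟩ fun t => ?_
      · by_cases hc : d < e c
        · simp only [hd' c hc, map_zero]
          exact zero_mem _
        · refine foxDeriv_mem_filtration f ?_
          rw [show d + 1 - e c + 1 = d + 1 + 1 - e c by lia]
          exact hrd c
      · have h1 : ∑ c, foxDeriv k f (r c) * x c t = foxDeriv k f (∑ c, r c * x c t) -
            ∑ c, nilCoeff k i (r c) • foxDeriv k f (x c t) := by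
          rw [map_sum, ← Finset.sum_sub_distrib]
          exact Finset.sum_congr rfl fun c _ => by rw [foxDeriv_mul, add_sub_cancel_right]
        rw [h1]
        -- The Leibniz correction involves only derivatives of `x c`, of degree below `e c ≤ d`, so
        -- it does not disturb the cancellation.
        refine sub_mem (foxDeriv_mem_filtration f (hsum t)) (sum_mem fun c _ => ?_)
        by_cases hc : d < e c
        · rw [hd' c hc, map_zero, zero_smul]
          exact zero_mem _
        · exact Submodule.smul_mem _ _
            (filtration_mono (by lia) (foxDeriv_mem_filtration f (hx c t)))

/-- The weighted degree of the relation is taken as small as possible, so that some coefficient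
attains it. -/
theorem exists_reduction {v : C → Q} {x : C → ι → PathAlgebra k Q} {e : C → ℕ}
    (hv : ∀ c, vertex k (v c) • x c = x c) (hx : ∀ c t, x c t ∈ filtration k Q (e c + 1))
    {r : C → PathAlgebra k Q} (hr : ∀ c, r c * vertex k (v c) = r c) (hr0 : r ≠ 0)
    (hsum : ∑ c, r c • x c = 0) :
    ∃ (c₀ : C) (s : C → PathAlgebra k Q), s c₀ = 0 ∧
      ∀ t, x c₀ t + ∑ c, s c * x c t ∈ filtration k Q (e c₀) := by
  classical
  have hex : ∃ d, ∀ c, r c ∈ filtration k Q (d - e c) := by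
    choose n hn using fun c => exists_mem_filtration (r c)
    refine ⟨∑ c, (n c + e c), fun c => filtration_mono ?_ (hn c)⟩
    have := Finset.single_le_sum (f := fun c => n c + e c) (fun _ _ => Nat.zero_le _)
      (Finset.mem_univ c)
    lia
  have hspec := Nat.find_spec hex
  have hmin := fun m => Nat.find_min hex (m := m)
  cases hd : Nat.find hex with
  | zero =>
    refine absurd (funext fun c => ?_) hr0
    have := hspec c
    rwa [hd, Nat.zero_sub, filtration_zero, Submodule.mem_bot] at this
  | succ d =>
    rw [hd] at hspec
    refine exists_add_sum_smul_mem_filtration hv hx d r hr hspec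
      (not_forall.1 (hmin d (by lia))) fun t => ?_
    have := congrFun hsum t
    simp only [Finset.sum_apply, Pi.smul_apply, smul_eq_mul, Pi.zero_apply] at this
    rw [this]
    exact zero_mem _

/-- Dependent generators are reduced until they are independent. The `+ 1` in the measure `∑ (e c +
1)` makes discarding a zero generator count as progress as well. -/
theorem exists_linearEquiv_pi_span_vertex_aux (N : ℕ) {C : Type*} [Fintype C] (v : C → Q)
    (x : C → ι → PathAlgebra k Q) (e : C → ℕ) (hv : ∀ c, vertex k (v c) • x c = x c)
    (hx : ∀ c t, x c t ∈ filtration k Q (e c)) (hN : ∑ c, (e c + 1) = N) :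
    ∃ (m : ℕ) (w : Fin m → Q), Nonempty (Submodule.span (PathAlgebra k Q) (Set.range x)
      ≃ₗ[PathAlgebra k Q] ∀ c, Submodule.span (PathAlgebra k Q) {vertex k (w c)}) := by
  classical
  induction N using Nat.strong_induction_on generalizing C with
  | _ N ih =>
  by_cases h0 : ∃ c, e c = 0
  · obtain ⟨c₀, hc₀⟩ := h0
    have hx0 : x c₀ = 0 := funext fun t => by
      have := hx c₀ t
      rwa [hc₀, filtration_zero, Submodule.mem_bot] at this
    have hspan : Submodule.span (PathAlgebra k Q) (Set.range fun c : {c // c ≠ c₀} => x c) =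
        Submodule.span (PathAlgebra k Q) (Set.range x) := by
      refine le_antisymm (Submodule.span_mono ?_) (Submodule.span_le.2 ?_)
      · rintro _ ⟨c, rfl⟩
        exact ⟨c, rfl⟩
      · rintro _ ⟨c, rfl⟩
        by_cases hc : c = c₀
        · rw [hc, hx0]
          exact zero_mem _
        · exact Submodule.subset_span ⟨⟨c, hc⟩, rfl⟩
    rw [← hspan]
    refine ih _ ?_ (fun c : {c // c ≠ c₀} => v c) _ (fun c => e c) (fun c => hv c) (fun c => hx c)
      rfl
    rw [← hN, ← Finset.add_sum_erase _ _ (Finset.mem_univ c₀),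
      ← Finset.sum_subtype (p := fun c => c ≠ c₀) (Finset.univ.erase c₀) (by simp)
        (fun c => e c + 1)]
    lia
  · by_cases hind : ∀ r : C → PathAlgebra k Q, (∀ c, r c * vertex k (v c) = r c) →
        ∑ c, r c • x c = 0 → r = 0
    · obtain ⟨E⟩ := exists_linearEquiv_pi_of_independent hv hind
      exact ⟨Fintype.card C, v ∘ (Fintype.equivFin C).symm, ⟨E.trans
        (LinearEquiv.piCongrLeft' (PathAlgebra k Q) _ (Fintype.equivFin C))⟩⟩
    · push Not at h0 hind
      obtain ⟨r, hr, hsum, hr0⟩ := hind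
      obtain ⟨c₀, s, hs, hmem⟩ := exists_reduction (e := fun c => e c - 1) hv
        (fun c t => by rw [Nat.sub_add_cancel (Nat.pos_of_ne_zero (h0 c))]; exact hx c t)
        hr hr0 hsum
      have hsum' : ∑ c, s c • x c = ∑ c ∈ Finset.univ.erase c₀, s c • x c := by
        rw [← Finset.add_sum_erase _ _ (Finset.mem_univ c₀), hs, zero_smul, zero_add]
      -- Multiplying by the idempotent restores `p_{v c₀} y = y` without raising the degree.
      let y : ι → PathAlgebra k Q := vertex k (v c₀) • (x c₀ + ∑ c, s c • x c)
      have hspan : Submodule.span (PathAlgebra k Q) (Set.range (Function.update x c₀ y)) =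
          Submodule.span (PathAlgebra k Q) (Set.range x) := by
        have h1 : ∀ c, c ≠ c₀ →
            x c ∈ Submodule.span (PathAlgebra k Q) (Set.range (Function.update x c₀ y)) :=
          fun c hc => Submodule.subset_span ⟨c, Function.update_of_ne hc _ _⟩
        have hy : y ∈ Submodule.span (PathAlgebra k Q) (Set.range (Function.update x c₀ y)) :=
          Submodule.subset_span ⟨c₀, Function.update_self ..⟩
        have hy' : x c₀ = y - vertex k (v c₀) • ∑ c, s c • x c := by
          rw [eq_sub_iff_add_eq]
          conv_lhs => rw [← hv c₀]
          rw [← smul_add]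
        refine le_antisymm (Submodule.span_le.2 ?_) (Submodule.span_le.2 ?_)
        · rintro _ ⟨c, rfl⟩
          by_cases hc : c = c₀
          · subst hc
            rw [Function.update_self]
            exact Submodule.smul_mem _ _ (add_mem (Submodule.subset_span ⟨_, rfl⟩)
              (sum_mem fun c _ => Submodule.smul_mem _ _ (Submodule.subset_span ⟨c, rfl⟩)))
          · rw [Function.update_of_ne hc]
            exact Submodule.subset_span ⟨c, rfl⟩
        · rintro _ ⟨c, rfl⟩
          by_cases hc : c = c₀
          · subst hc
            rw [hy', hsum']
            exact sub_mem hy (Submodule.smul_mem _ _ (sum_mem fun c' hc' =>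
              Submodule.smul_mem _ _ (h1 c' (Finset.ne_of_mem_erase hc'))))
          · exact h1 c hc
      rw [← hspan]
      refine ih _ ?_ v _ (Function.update e c₀ (e c₀ - 1)) (fun c => ?_) (fun c t => ?_) rfl
      · rw [← hN]
        refine Finset.sum_lt_sum (fun c _ => ?_) ⟨c₀, Finset.mem_univ _, ?_⟩
        · by_cases hc : c = c₀
          · subst hc
            rw [Function.update_self]
            lia
          · rw [Function.update_of_ne hc]
        · rw [Function.update_self]
          have := h0 c₀
          lia
      · by_cases hc : c = c₀
        · subst hc
          rw [Function.update_self, smul_smul, vertex_mul_vertex]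
        · rw [Function.update_of_ne hc, hv]
      · by_cases hc : c = c₀
        · subst hc
          rw [Function.update_self, Function.update_self]
          refine vertex_mul_mem_filtration ?_ _
          simpa only [Pi.add_apply, Finset.sum_apply, Pi.smul_apply, smul_eq_mul] using hmem t
        · rw [Function.update_of_ne hc, Function.update_of_ne hc]
          exact hx c t

/-- Finitely generated submodules of free modules over the path algebra are finite direct sums of
modules `R p_i`. -/
theorem exists_linearEquiv_pi_span_vertex [Finite ι]
    (K : Submodule (PathAlgebra k Q) (ι → PathAlgebra k Q)) (hK : K.FG) :
    ∃ (m : ℕ) (w : Fin m → Q), Nonempty (K ≃ₗ[PathAlgebra k Q]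
      ∀ c, Submodule.span (PathAlgebra k Q) {vertex k (w c)}) := by
  obtain ⟨n, g, rfl⟩ := Submodule.fg_iff_exists_fin_generating_family.1 hK
  -- As `1 = ∑ p_i`, each generator `g` may be replaced by its pieces `p_i g`.
  have hspan : Submodule.span (PathAlgebra k Q)
      (Set.range fun c : Q × Fin n => vertex k c.1 • g c.2) =
      Submodule.span (PathAlgebra k Q) (Set.range g) := by
    refine le_antisymm (Submodule.span_le.2 ?_) (Submodule.span_le.2 ?_)
    · rintro _ ⟨c, rfl⟩
      exact Submodule.smul_mem _ _ (Submodule.subset_span ⟨_, rfl⟩)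
    · rintro _ ⟨c, rfl⟩
      rw [← one_smul (PathAlgebra k Q) (g c), one_def, Finset.sum_smul]
      exact sum_mem fun i _ => Submodule.subset_span ⟨(i, c), rfl⟩
  rw [← hspan]
  have := Fintype.ofFinite ι
  choose e he using fun (c : Q × Fin n) (t : ι) =>
    exists_mem_filtration ((vertex k c.1 • g c.2) t)
  refine exists_linearEquiv_pi_span_vertex_aux _ (fun c => c.1) _ (fun c => ∑ t, e c t)
    (fun c => ?_) (fun c t => ?_) rfl
  · rw [smul_smul, vertex_mul_vertex]
  · exact filtration_mono (Finset.single_le_sum (f := e c) (fun _ _ => Nat.zero_le _)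
      (Finset.mem_univ t)) (he c t)

end WeakAlgorithm

end PathAlgebra

/-! ### Classes of modules in Grothendieck groups. -/

namespace K0

section Modules

variable {R : Type u} [Ring R] {P : ObjectProperty (ModuleCat.{v} R)}

theorem of_exact {A B C : Type v} [AddCommGroup A] [Module R A] [AddCommGroup B] [Module R B]
    [AddCommGroup C] [Module R C] (f : A →ₗ[R] B) (g : B →ₗ[R] C) (hf : Function.Injective f)
    (hfg : Function.Exact f g) (hg : Function.Surjective g) (hA : P (ModuleCat.of R A))
    (hB : P (ModuleCat.of R B)) (hC : P (ModuleCat.of R C)) :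
    (of _ hB : K0 P) = of _ hA + of _ hC := by
  let S : ShortComplex (ModuleCat.{v} R) := ShortComplex.mk (ModuleCat.ofHom f) (ModuleCat.ofHom g)
    (by ext x; exact hfg.apply_apply_eq_zero x)
  have hS : S.ShortExact :=
    { exact := (ShortComplex.ShortExact.moduleCat_exact_iff_function_exact S).2 hfg
      mono_f := (ModuleCat.mono_iff_injective _).2 hf
      epi_g := (ModuleCat.epi_iff_surjective _).2 hg }
  exact of_shortExact S hS hA hB hC

theorem of_subsingleton {A : Type v} [AddCommGroup A] [Module R A] [Subsingleton A]
    (hA : P (ModuleCat.of R A)) : (of _ hA : K0 P) = 0 := by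
  have h := of_exact (0 : A →ₗ[R] A) (0 : A →ₗ[R] A) (Function.injective_of_subsingleton _)
    (fun x => ⟨fun _ => ⟨0, Subsingleton.elim _ _⟩, fun _ => rfl⟩)
    (fun x => ⟨0, Subsingleton.elim _ _⟩) hA hA hA
  simpa using h

/-- An isomorphism is a short exact sequence with zero third term, whence the condition that `P`
contains a zero module. -/
theorem of_congr {A B : Type v} [AddCommGroup A] [Module R A] [AddCommGroup B] [Module R B]
    (e : A ≃ₗ[R] B) (hA : P (ModuleCat.of R A)) (hB : P (ModuleCat.of R B))
    (h0 : P (ModuleCat.of R PUnit.{v + 1})) : (of _ hA : K0 P) = of _ hB := by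
  have h := of_exact e.toLinearMap (0 : B →ₗ[R] PUnit.{v + 1}) e.injective
    (fun x => ⟨fun _ => ⟨e.symm x, e.apply_symm_apply x⟩, fun _ => rfl⟩)
    (fun x => ⟨0, Subsingleton.elim _ _⟩) hA hB h0
  rw [h, of_subsingleton h0, add_zero]

theorem of_pi {n : ℕ} (X : Fin n → Type v) [∀ i, AddCommGroup (X i)] [∀ i, Module R (X i)]
    (hP : ∀ (m : ℕ) (f : Fin m → Fin n), P (ModuleCat.of R (∀ i, X (f i))))
    (hX : ∀ i, P (ModuleCat.of R (X i))) (h : P (ModuleCat.of R (∀ i, X i))) :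
    (of _ h : K0 P) = ∑ i, of _ (hX i) := by
  induction n with
  | zero => simpa using of_subsingleton h
  | succ n ih =>
    rw [Fin.sum_univ_succ, ← ih (fun i => X i.succ) (fun m f => hP m fun i => (f i).succ)
      (fun i => hX i.succ) (hP n Fin.succ)]
    refine of_exact (LinearMap.single R X 0)
      (LinearMap.pi fun i : Fin n => LinearMap.proj i.succ)
      (LinearMap.ker_eq_bot.1 (LinearMap.ker_single R X 0))
      (fun x => ⟨fun hx => ⟨x 0, ?_⟩, ?_⟩) (fun x => ⟨Fin.cons 0 x, ?_⟩) _ _ _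
    · ext i
      refine Fin.cases ?_ (fun i => ?_) i
      · simp
      · have := congrFun hx i
        simp only [LinearMap.pi_apply, LinearMap.proj_apply, Pi.zero_apply] at this
        rw [this]
        simp
    · rintro ⟨y, rfl⟩
      ext i
      simp
    · ext i
      simp

theorem induction {C : Type u} [Category.{v} C] [Abelian C] {P : ObjectProperty C}
    {p : AddSubgroup (K0 P)} (h : ∀ X hX, of X hX ∈ p) (x : K0 P) : x ∈ p := by
  obtain ⟨x, rfl⟩ := QuotientAddGroup.mk_surjective x
  induction x using FreeAbelianGroup.induction_on with
  | zero => exact zero_mem p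
  | of x => exact h x.obj x.property
  | neg x hx => exact neg_mem hx
  | add x y hx hy => exact add_mem hx hy

/-- The homomorphism out of `K_0` given by a function that is additive on short exact
sequences. -/
def lift {C : Type u} [Category.{v} C] [Abelian C] {P : ObjectProperty C} {G : Type*}
    [AddCommGroup G] (f : C → G)
    (hf : ∀ S : ShortComplex C, S.ShortExact → P S.X₁ → P S.X₂ → P S.X₃ →
      f S.X₂ = f S.X₁ + f S.X₃) : K0 P →+ G :=
  QuotientAddGroup.lift _ (FreeAbelianGroup.lift fun X : P.FullSubcategory => f X.obj) <| by
    rw [AddSubgroup.closure_le]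
    rintro _ ⟨S, hS, h₁, h₂, h₃, rfl⟩
    simp only [SetLike.mem_coe, AddMonoidHom.mem_ker, map_sub, map_add,
      FreeAbelianGroup.lift_apply_of]
    rw [hf S hS h₁ h₂ h₃, sub_self]

theorem lift_of {C : Type u} [Category.{v} C] [Abelian C] {P : ObjectProperty C} {G : Type*}
    [AddCommGroup G] (f : C → G)
    (hf : ∀ S : ShortComplex C, S.ShortExact → P S.X₁ → P S.X₂ → P S.X₃ →
      f S.X₂ = f S.X₁ + f S.X₃) (X : C) (hX : P X) : lift f hf (of X hX) = f X :=
  FreeAbelianGroup.lift_apply_of _ _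

end Modules

end K0

/-! ### Generation by the classes `[R p_i]`. -/

namespace PathAlgebra

variable {k : Type u} [Field k] {Q : Type v} [Quiver.{w} Q] [Fintype Q]

theorem projModules_leftIdeal_vertex (i : Q) :
    projModules (PathAlgebra k Q) (leftIdeal (PathAlgebra k Q) (vertex k i)) :=
  leftIdeal_mem_projModules _ (vertex_mul_vertex k i)

theorem projModules_pi_vertex {n : ℕ} (w : Fin n → Q) :
    projModules (PathAlgebra k Q) (ModuleCat.of (PathAlgebra k Q)
      (∀ c, Submodule.span (PathAlgebra k Q) {vertex k (w c)})) := by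
  have h1 : ∀ c, Module.Finite (PathAlgebra k Q)
      (Submodule.span (PathAlgebra k Q) {vertex k (w c)}) :=
    fun c => (projModules_leftIdeal_vertex (w c)).1
  have h2 : ∀ c, Module.Projective (PathAlgebra k Q)
      (Submodule.span (PathAlgebra k Q) {vertex k (w c)}) :=
    fun c => (projModules_leftIdeal_vertex (w c)).2
  exact ⟨Module.Finite.pi, .of_equiv (DirectSum.linearEquivFunOnFintype (PathAlgebra k Q) _
    fun c => Submodule.span (PathAlgebra k Q) {vertex k (w c)})⟩

theorem projModules_of_linearEquiv {R : Type u} [Ring R] {A B : Type u} [AddCommGroup A]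
    [Module R A] [AddCommGroup B] [Module R B] (e : A ≃ₗ[R] B)
    (h : projModules R (ModuleCat.of R A)) : projModules R (ModuleCat.of R B) := by
  obtain ⟨h1, h2⟩ : Module.Finite R A ∧ Module.Projective R A := h
  exact ⟨Module.Finite.equiv e, .of_equiv e⟩

theorem projModules_punit {R : Type u} [Ring R] :
    projModules R (ModuleCat.of R PUnit.{u + 1}) :=
  ⟨inferInstanceAs (Module.Finite R PUnit.{u + 1}),
    inferInstanceAs (Module.Projective R PUnit.{u + 1})⟩

variable [∀ i j : Q, Finite (i ⟶ j)] {P : ObjectProperty (ModuleCat.{max u v w} (PathAlgebra k Q))}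

theorem of_mem_closure_of_fg (hP : projModules (PathAlgebra k Q) ≤ P) {n : ℕ}
    (K : Submodule (PathAlgebra k Q) (Fin n → PathAlgebra k Q)) (hK : K.FG)
    (h : P (ModuleCat.of _ K)) :
    (K0.of _ h : K0 P) ∈ AddSubgroup.closure (Set.range fun i : Q =>
      (K0.of _ (hP _ (projModules_leftIdeal_vertex i)) : K0 P)) := by
  obtain ⟨m, w, ⟨e⟩⟩ := exists_linearEquiv_pi_span_vertex K hK
  have h1 := hP _ (projModules_pi_vertex (k := k) w)
  rw [K0.of_congr e h h1 (hP _ projModules_punit), K0.of_pi _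
    (fun l f => hP _ (projModules_pi_vertex (k := k) fun i => w (f i)))
    (fun c => hP _ (projModules_leftIdeal_vertex (w c)))]
  exact sum_mem fun c _ => AddSubgroup.subset_closure ⟨w c, rfl⟩

/-- A presentation gives `[M] = [R^n] - [ker]`, and both terms are sums of classes `[R p_i]`.
Leaving `P` general covers `K_0(R)` and `K_0(fp(R))` at once. -/
theorem of_mem_closure (hP : projModules (PathAlgebra k Q) ≤ P) (M : ModuleCat (PathAlgebra k Q))
    (hM : P M) (hfp : fpModules _ M) :
    (K0.of M hM : K0 P) ∈ AddSubgroup.closure (Set.range fun i : Q =>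
      (K0.of _ (hP _ (projModules_leftIdeal_vertex i)) : K0 P)) := by
  have hfp' : Module.FinitePresentation (PathAlgebra k Q) M := hfp
  obtain ⟨n, f, hf⟩ := Module.Finite.exists_fin' (PathAlgebra k Q) M
  have hK := Module.FinitePresentation.fg_ker f hf
  have hKproj : projModules _ (ModuleCat.of (PathAlgebra k Q) (LinearMap.ker f)) := by
    obtain ⟨m, w, ⟨e⟩⟩ := exists_linearEquiv_pi_span_vertex _ hK
    exact projModules_of_linearEquiv e.symm (projModules_pi_vertex w)
  have hFproj : projModules _ (ModuleCat.of (PathAlgebra k Q) (Fin n → PathAlgebra k Q)) :=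
    ⟨inferInstanceAs (Module.Finite _ (Fin n → PathAlgebra k Q)),
      inferInstanceAs (Module.Projective _ (Fin n → PathAlgebra k Q))⟩
  have h := K0.of_exact (P := P) (LinearMap.ker f).subtype f Subtype.val_injective
    (LinearMap.exact_subtype_ker_map f) hf (hP _ hKproj) (hP _ hFproj) hM
  have h1 := of_mem_closure_of_fg hP (LinearMap.ker f) hK (hP _ hKproj)
  -- The free module is itself treated as a submodule of `R^n`.
  have hT : P (ModuleCat.of _ (⊤ : Submodule (PathAlgebra k Q) (Fin n → PathAlgebra k Q))) :=
    hP _ (projModules_of_linearEquiv Submodule.topEquiv.symm hFproj)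
  have h2 := of_mem_closure_of_fg hP ⊤ Module.Finite.fg_top hT
  rw [K0.of_congr Submodule.topEquiv hT (hP _ hFproj) (hP _ projModules_punit), h] at h2
  exact (AddSubgroup.add_mem_cancel_left _ h1).1 h2

end PathAlgebra

/-! ### Additivity of the index by the snake lemma. -/

namespace LinearMap

section Index

variable {k : Type*} [Field k] {A₁ A₂ A₃ B₁ B₂ B₃ : Type*} [AddCommGroup A₁]
  [Module k A₁] [AddCommGroup A₂]
  [Module k A₂] [AddCommGroup A₃] [Module k A₃] [AddCommGroup B₁] [Module k B₁] [AddCommGroup B₂]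
  [Module k B₂] [AddCommGroup B₃] [Module k B₃] {f₁ : A₁ →ₗ[k] B₁} {f₂ : A₂ →ₗ[k] B₂}
  {f₃ : A₃ →ₗ[k] B₃} {a₁ : A₁ →ₗ[k] A₂} {a₂ : A₂ →ₗ[k] A₃} {b₁ : B₁ →ₗ[k] B₂} {b₂ : B₂ →ₗ[k] B₃}

/-- The map induced on kernels by a commutative square. -/
def kerMap (h : b₁ ∘ₗ f₁ = f₂ ∘ₗ a₁) : ker f₁ →ₗ[k] ker f₂ :=
  a₁.restrict fun x hx => by
    rw [mem_ker, ← comp_apply, ← h, comp_apply, mem_ker.1 hx, map_zero]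

/-- The map induced on cokernels by a commutative square. -/
def cokerMap (h : b₁ ∘ₗ f₁ = f₂ ∘ₗ a₁) : (B₁ ⧸ range f₁) →ₗ[k] (B₂ ⧸ range f₂) :=
  Submodule.mapQ _ _ b₁ (by
    rintro _ ⟨x, rfl⟩
    exact ⟨a₁ x, (LinearMap.congr_fun h x).symm⟩)

theorem kerMap_injective (h : b₁ ∘ₗ f₁ = f₂ ∘ₗ a₁) (ha : Function.Injective a₁) :
    Function.Injective (kerMap h) := fun _ _ hxy => Subtype.ext (ha (congrArg Subtype.val hxy))

theorem kerMap_exact (h : b₁ ∘ₗ f₁ = f₂ ∘ₗ a₁) (h' : b₂ ∘ₗ f₂ = f₃ ∘ₗ a₂)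
    (ha : Function.Exact a₁ a₂) (hb : Function.Injective b₁) :
    Function.Exact (kerMap h) (kerMap h') := by
  rintro ⟨x, hx⟩
  refine ⟨fun hx' => ?_, ?_⟩
  · obtain ⟨y, rfl⟩ := (ha x).1 (congrArg Subtype.val hx')
    refine ⟨⟨y, hb ?_⟩, rfl⟩
    rw [map_zero, ← comp_apply, h]
    exact hx
  · rintro ⟨y, hy⟩
    rw [← hy]
    exact Subtype.ext (ha.apply_apply_eq_zero y.1)

theorem cokerMap_surjective (h : b₁ ∘ₗ f₁ = f₂ ∘ₗ a₁) (hb : Function.Surjective b₁) :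
    Function.Surjective (cokerMap h) := by
  intro y
  obtain ⟨y, rfl⟩ := Submodule.mkQ_surjective _ y
  obtain ⟨x, rfl⟩ := hb y
  exact ⟨Submodule.Quotient.mk x, rfl⟩

theorem cokerMap_exact (h : b₁ ∘ₗ f₁ = f₂ ∘ₗ a₁) (h' : b₂ ∘ₗ f₂ = f₃ ∘ₗ a₂)
    (hb : Function.Exact b₁ b₂) (ha : Function.Surjective a₂) :
    Function.Exact (cokerMap h) (cokerMap h') := by
  intro y
  obtain ⟨y, rfl⟩ := Submodule.mkQ_surjective _ y
  refine ⟨fun hy => ?_, ?_⟩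
  · obtain ⟨z, hz⟩ := (Submodule.Quotient.mk_eq_zero _).1 hy
    obtain ⟨z, rfl⟩ := ha z
    have h1 : b₂ (y - f₂ z) = 0 := by
      rw [map_sub, sub_eq_zero, ← hz, ← comp_apply, ← comp_apply, h']
    obtain ⟨x, hx⟩ := (hb _).1 h1
    refine ⟨Submodule.Quotient.mk x, (Submodule.Quotient.eq _).2 ?_⟩
    rw [hx]
    exact ⟨-z, by rw [map_neg]; abel⟩
  · rintro ⟨x, hx⟩
    obtain ⟨x, rfl⟩ := Submodule.mkQ_surjective _ x
    rw [← hx]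
    refine (Submodule.Quotient.mk_eq_zero _).2 ?_
    rw [hb.apply_apply_eq_zero]
    exact zero_mem _

theorem exists_connecting (h : b₁ ∘ₗ f₁ = f₂ ∘ₗ a₁) (h' : b₂ ∘ₗ f₂ = f₃ ∘ₗ a₂)
    (ha : Function.Exact a₁ a₂) (ha₂ : Function.Surjective a₂) (hb : Function.Exact b₁ b₂)
    (hb₁ : Function.Injective b₁) : ∃ δ : ker f₃ →ₗ[k] (B₁ ⧸ range f₁),
      Function.Exact (kerMap h') δ ∧ Function.Exact δ (cokerMap h) := by
  have hι₂ : Function.Exact (ker f₂).subtype f₂ := exact_subtype_ker_map f₂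
  have hι₃ : Function.Exact (ker f₃).subtype f₃ := exact_subtype_ker_map f₃
  have hπ₁ : Function.Exact f₁ (range f₁).mkQ := exact_map_mkQ_range f₁
  have hπ₂ : Function.Exact f₂ (range f₂).mkQ := exact_map_mkQ_range f₂
  refine ⟨SnakeLemma.δ' f₁ f₂ f₃ a₁ a₂ ha b₁ b₂ hb h h' (ker f₃).subtype hι₃ (range f₁).mkQ hπ₁
    ha₂ hb₁, ?_, ?_⟩
  · exact SnakeLemma.exact_δ'_right f₁ f₂ f₃ a₁ a₂ ha b₁ b₂ hb h h' (ker f₂).subtype hι₂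
      (ker f₃).subtype hι₃ (range f₁).mkQ hπ₁ ha₂ hb₁ (kerMap h') rfl Subtype.val_injective
  · exact SnakeLemma.exact_δ'_left f₁ f₂ f₃ a₁ a₂ ha b₁ b₂ hb h h' (ker f₃).subtype hι₃
      (range f₁).mkQ hπ₁ (range f₂).mkQ hπ₂ ha₂ hb₁ (cokerMap h) rfl (Submodule.mkQ_surjective _)

/-- When `ker f₂ = 0`, the connecting map embeds `ker f₃` into the cokernel of `f₁`. -/
theorem finite_ker_of_exact (h : b₁ ∘ₗ f₁ = f₂ ∘ₗ a₁) (h' : b₂ ∘ₗ f₂ = f₃ ∘ₗ a₂)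
    (ha : Function.Exact a₁ a₂) (ha₂ : Function.Surjective a₂) (hb : Function.Exact b₁ b₂)
    (hb₁ : Function.Injective b₁) (hf₂ : Function.Injective f₂)
    [Module.Finite k (B₁ ⧸ range f₁)] : Module.Finite k (ker f₃) := by
  obtain ⟨δ, hδ, -⟩ := exists_connecting h h' ha ha₂ hb hb₁
  refine Module.Finite.of_injective δ ((injective_iff_map_eq_zero δ).2 fun x hx => ?_)
  obtain ⟨⟨y, hy⟩, rfl⟩ := (hδ x).1 hx
  have : y = 0 := hf₂ (by rw [map_zero]; exact hy)
  subst this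
  exact Subtype.ext (map_zero a₂)

/-- Alternating dimension count along the six-term exact sequence of the snake lemma. -/
theorem index_eq_add (h : b₁ ∘ₗ f₁ = f₂ ∘ₗ a₁) (h' : b₂ ∘ₗ f₂ = f₃ ∘ₗ a₂)
    (ha₁ : Function.Injective a₁) (ha : Function.Exact a₁ a₂) (ha₂ : Function.Surjective a₂)
    (hb₁ : Function.Injective b₁) (hb : Function.Exact b₁ b₂) (hb₂ : Function.Surjective b₂)
    [Module.Finite k (ker f₁)] [Module.Finite k (ker f₂)] [Module.Finite k (ker f₃)]
    [Module.Finite k (B₁ ⧸ range f₁)] [Module.Finite k (B₂ ⧸ range f₂)]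
    [Module.Finite k (B₃ ⧸ range f₃)] : index f₂ = index f₁ + index f₃ := by
  obtain ⟨δ, hδ, hδ'⟩ := exists_connecting h h' ha ha₂ hb hb₁
  have e1 := (kerMap h).finrank_range_add_finrank_ker
  have e2 := (kerMap h').finrank_range_add_finrank_ker
  have e3 := δ.finrank_range_add_finrank_ker
  have e4 := (cokerMap h).finrank_range_add_finrank_ker
  have e5 := (cokerMap h').finrank_range_add_finrank_ker
  rw [ker_eq_bot.2 (kerMap_injective h ha₁), finrank_bot] at e1
  rw [(kerMap_exact h h' ha hb₁).linearMap_ker_eq] at e2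
  rw [hδ.linearMap_ker_eq] at e3
  rw [hδ'.linearMap_ker_eq] at e4
  rw [(cokerMap_exact h h' hb ha₂).linearMap_ker_eq,
    range_eq_top.2 (cokerMap_surjective h' hb₂), finrank_top] at e5
  rw [index_eq_finrank_sub, index_eq_finrank_sub, index_eq_finrank_sub]
  lia

end Index

end LinearMap

/-! ### The two-term complex `⨁ p_j M → p_i M` and its index. -/

namespace PathAlgebra

section VertexSpace

variable (k : Type u) [Field k] {Q : Type v} [Quiver.{w} Q] [Fintype Q]
  (M : Type*) [AddCommGroup M] [Module (PathAlgebra k Q) M] [Module k M]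
  [IsScalarTower k (PathAlgebra k Q) M]
  {N : Type*} [AddCommGroup N] [Module (PathAlgebra k Q) N] [Module k N]
  [IsScalarTower k (PathAlgebra k Q) N]
  {L : Type*} [AddCommGroup L] [Module (PathAlgebra k Q) L] [Module k L]
  [IsScalarTower k (PathAlgebra k Q) L]

/-- The vector space `p_i M` attached to the vertex `i` by a module over the path algebra. -/
def vertexSpace (i : Q) : Submodule k M where
  carrier := {m | vertex k i • m = m}
  add_mem' {x y} hx hy := by
    change vertex k i • (x + y) = x + y
    rw [smul_add, hx, hy]
  zero_mem' := smul_zero _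
  smul_mem' c x hx := by
    change vertex k i • (c • x) = c • x
    rw [smul_comm, hx]

theorem mem_vertexSpace {i : Q} {m : M} : m ∈ vertexSpace k M i ↔ vertex k i • m = m := Iff.rfl

/-- The projection of a module over the path algebra onto the space of a vertex. -/
def vertexProj (i : Q) : M →ₗ[k] vertexSpace k M i :=
  (Algebra.lsmul k k M (vertex k i)).codRestrict _ fun m => by
    rw [mem_vertexSpace, Algebra.lsmul_coe, smul_smul, vertex_mul_vertex]

theorem coe_vertexProj (i : Q) (m : M) : (vertexProj k M i m : M) = vertex k i • m := rfl

theorem vertexProj_of_mem {i : Q} (m : vertexSpace k M i) : vertexProj k M i m = m :=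
  Subtype.ext m.2

/-- The action of an arrow on the spaces attached to its ends. -/
def arrowMap {i j : Q} (e : i ⟶ j) : vertexSpace k M j →ₗ[k] vertexSpace k M i :=
  (Algebra.lsmul k k M (arrow k e)).restrict fun m _ => by
    rw [mem_vertexSpace, Algebra.lsmul_coe, smul_smul, vertex_mul_arrow]

theorem coe_arrowMap {i j : Q} (e : i ⟶ j) (m : vertexSpace k M j) :
    (arrowMap k M e m : M) = arrow k e • (m : M) := rfl

variable {M k}

/-- The restriction of a homomorphism to the spaces of a vertex. -/
def vertexSpaceMap (f : M →ₗ[PathAlgebra k Q] N) (i : Q) :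
    vertexSpace k M i →ₗ[k] vertexSpace k N i :=
  (f.restrictScalars k).restrict fun m hm => by
    rw [mem_vertexSpace, LinearMap.restrictScalars_apply, ← map_smul, (mem_vertexSpace k M).1 hm]

theorem coe_vertexSpaceMap (f : M →ₗ[PathAlgebra k Q] N) {i : Q} (m : vertexSpace k M i) :
    (vertexSpaceMap f i m : N) = f m := rfl

theorem vertexSpaceMap_injective {f : M →ₗ[PathAlgebra k Q] N} (hf : Function.Injective f)
    (i : Q) : Function.Injective (vertexSpaceMap f i) :=
  fun _ _ h => Subtype.ext (hf (congrArg Subtype.val h))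

theorem vertexSpaceMap_surjective {f : M →ₗ[PathAlgebra k Q] N} (hf : Function.Surjective f)
    (i : Q) : Function.Surjective (vertexSpaceMap f i) := by
  intro y
  obtain ⟨x, hx⟩ := hf y
  refine ⟨vertexProj k M i x, Subtype.ext ?_⟩
  rw [coe_vertexSpaceMap, coe_vertexProj, map_smul, hx]
  exact y.2

theorem vertexSpaceMap_exact {f : M →ₗ[PathAlgebra k Q] N} {g : N →ₗ[PathAlgebra k Q] L}
    (h : Function.Exact f g) (i : Q) :
    Function.Exact (vertexSpaceMap f i) (vertexSpaceMap g i) := by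
  intro y
  refine ⟨fun hy => ?_, ?_⟩
  · obtain ⟨x, hx⟩ := (h y).1 (congrArg Subtype.val hy)
    refine ⟨vertexProj k M i x, Subtype.ext ?_⟩
    rw [coe_vertexSpaceMap, coe_vertexProj, map_smul, hx]
    exact y.2
  · rintro ⟨x, rfl⟩
    exact Subtype.ext (h.apply_apply_eq_zero x.1)

/-- The map on `⨁ p_j M` induced by a homomorphism. -/
def arrowsSpaceMap (f : M →ₗ[PathAlgebra k Q] N) (i : Q) :
    (∀ e : ArrowsFrom i, vertexSpace k M e.1) →ₗ[k] (∀ e : ArrowsFrom i, vertexSpace k N e.1) :=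
  LinearMap.pi fun e => vertexSpaceMap f e.1 ∘ₗ LinearMap.proj e

theorem arrowsSpaceMap_apply (f : M →ₗ[PathAlgebra k Q] N) {i : Q}
    (x : ∀ e : ArrowsFrom i, vertexSpace k M e.1) (e : ArrowsFrom i) :
    arrowsSpaceMap f i x e = vertexSpaceMap f e.1 (x e) := rfl

theorem arrowsSpaceMap_injective {f : M →ₗ[PathAlgebra k Q] N} (hf : Function.Injective f)
    (i : Q) : Function.Injective (arrowsSpaceMap f i) :=
  fun _ _ h => funext fun e => vertexSpaceMap_injective hf e.1 (congrFun h e)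

theorem arrowsSpaceMap_surjective {f : M →ₗ[PathAlgebra k Q] N} (hf : Function.Surjective f)
    (i : Q) : Function.Surjective (arrowsSpaceMap f i) := by
  intro y
  choose x hx using fun e => vertexSpaceMap_surjective hf e.1 (y e)
  exact ⟨x, funext hx⟩

theorem arrowsSpaceMap_exact {f : M →ₗ[PathAlgebra k Q] N} {g : N →ₗ[PathAlgebra k Q] L}
    (h : Function.Exact f g) (i : Q) :
    Function.Exact (arrowsSpaceMap f i) (arrowsSpaceMap g i) := by
  have hex : ∀ (e : ArrowsFrom i) (y : vertexSpace k N e.1), vertexSpaceMap g e.1 y = 0 ↔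
      ∃ x, vertexSpaceMap f e.1 x = y := fun e => vertexSpaceMap_exact h e.1
  intro y
  refine ⟨fun hy => ?_, ?_⟩
  · choose x hx using fun e => (hex e (y e)).1 (congrFun hy e)
    exact ⟨x, funext hx⟩
  · rintro ⟨x, rfl⟩
    exact funext fun e => (hex e _).2 ⟨x e, rfl⟩

variable [∀ i j : Q, Finite (i ⟶ j)]

variable (k M) in
/-- The map `⨁ p_j M → p_i M`, indexed by the arrows `i ⟶ j` out of `i`, given by the action of
these arrows. -/
def arrowsMap (i : Q) : (∀ e : ArrowsFrom i, vertexSpace k M e.1) →ₗ[k] vertexSpace k M i :=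
  ∑ e : ArrowsFrom i, arrowMap k M e.2 ∘ₗ LinearMap.proj e

theorem coe_arrowsMap {i : Q} (x : ∀ e : ArrowsFrom i, vertexSpace k M e.1) :
    (arrowsMap k M i x : M) = ∑ e : ArrowsFrom i, arrow k e.2 • (x e : M) := by
  simp [arrowsMap, LinearMap.sum_apply, coe_arrowMap]

theorem arrowsMap_naturality (f : M →ₗ[PathAlgebra k Q] N) (i : Q) :
    vertexSpaceMap f i ∘ₗ arrowsMap k M i = arrowsMap k N i ∘ₗ arrowsSpaceMap f i := by
  refine LinearMap.ext fun x => Subtype.ext ?_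
  simp only [LinearMap.comp_apply, coe_vertexSpaceMap, coe_arrowsMap, map_sum, map_smul,
    arrowsSpaceMap_apply]

/-- By the Fox formula, `p_i r m - ε_i(r) p_i m` is a sum of arrows applied to `∂_e r m`. Thus `R`
acts on the cokernel through `ε_i`, and generators of `M` over `R` span the cokernel over `k`. -/
theorem mkQ_vertexProj_smul (i : Q) (r : PathAlgebra k Q) (m : M) :
    (LinearMap.range (arrowsMap k M i)).mkQ (vertexProj k M i (r • m)) =
      nilCoeff k i r • (LinearMap.range (arrowsMap k M i)).mkQ (vertexProj k M i m) := by
  rw [← map_smul, ← sub_eq_zero, ← map_sub]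
  refine (Submodule.Quotient.mk_eq_zero _).2 ⟨fun e => ⟨foxDeriv k e.2 r • m, ?_⟩, ?_⟩
  · rw [mem_vertexSpace, smul_smul, vertex_mul_foxDeriv]
  · refine Subtype.ext ?_
    rw [coe_arrowsMap, Submodule.coe_sub, Submodule.coe_smul, coe_vertexProj, coe_vertexProj,
      smul_smul, vertex_mul_eq, add_smul, smul_assoc, add_sub_cancel_left, Finset.sum_smul]
    simp only [smul_smul]

theorem finite_coker_arrowsMap [Module.Finite (PathAlgebra k Q) M] (i : Q) :
    Module.Finite k (vertexSpace k M i ⧸ LinearMap.range (arrowsMap k M i)) := by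
  obtain ⟨S, hS⟩ := (Module.finite_def (R := PathAlgebra k Q) (M := M)).1 inferInstance
  let π : M →ₗ[k] (vertexSpace k M i ⧸ LinearMap.range (arrowsMap k M i)) :=
    (LinearMap.range (arrowsMap k M i)).mkQ ∘ₗ vertexProj k M i
  have h : ∀ m, π m ∈ Submodule.span k (π '' S) := by
    intro m
    have hm : m ∈ Submodule.span (PathAlgebra k Q) (S : Set M) := hS ▸ Submodule.mem_top
    induction hm using Submodule.span_induction with
    | mem x hx => exact Submodule.subset_span ⟨x, hx, rfl⟩
    | zero => rw [map_zero]; exact zero_mem _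
    | add x y _ _ hx hy => rw [map_add]; exact add_mem hx hy
    | smul r x _ hx =>
      have : π (r • x) = nilCoeff k i r • π x := mkQ_vertexProj_smul i r x
      rw [this]
      exact Submodule.smul_mem _ _ hx
  refine ⟨?_⟩
  rw [Submodule.fg_def]
  refine ⟨π '' S, S.finite_toSet.image π, top_unique fun y _ => ?_⟩
  obtain ⟨y, rfl⟩ := Submodule.mkQ_surjective _ y
  rw [← vertexProj_of_mem k M y]
  exact h y

/-- For submodules of free modules, differentiating `∑ e x_e = 0` along `e₀` leaves `x_{e₀} = 0`. -/
theorem arrowsMap_injective {ι : Type*} {f : M →ₗ[PathAlgebra k Q] (ι → PathAlgebra k Q)}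
    (hf : Function.Injective f) (i : Q) : Function.Injective (arrowsMap k M i) := by
  refine (injective_iff_map_eq_zero _).2 fun x hx => funext fun e₀ => Subtype.ext (hf ?_)
  have h1 : ∑ e : ArrowsFrom i, arrow k e.2 • f (x e) = 0 := by
    simp only [← map_smul]
    rw [← map_sum, ← coe_arrowsMap, hx]
    exact map_zero f
  refine (funext fun t => ?_ : f (x e₀) = 0).trans (map_zero f).symm
  have h2 : ∑ e : ArrowsFrom i, arrow k e.2 * f (x e) t = 0 := by
    have := congrFun h1 t
    rw [Finset.sum_apply] at this
    exact this
  have h3 := congrArg (foxDeriv k e₀.2) h2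
  rw [map_sum, map_zero, Finset.sum_eq_single e₀] at h3
  · rw [foxDeriv_arrow_mul, arrowDelta_self, ← smul_eq_mul, ← Pi.smul_apply, ← map_smul,
      (mem_vertexSpace k M).1 (x e₀).2] at h3
    exact h3
  · rintro ⟨j, e⟩ - he
    rw [foxDeriv_arrow_mul, arrowDelta_of_ne, zero_mul]
    rintro h
    cases h
    exact he rfl
  · simp

/-- In a presentation `0 → K → R^n → M → 0` the middle map is injective, so the kernel for `M`
embeds into the cokernel for the finitely generated module `K`. -/
theorem finite_ker_arrowsMap [Module.FinitePresentation (PathAlgebra k Q) M] (i : Q) :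
    Module.Finite k (LinearMap.ker (arrowsMap k M i)) := by
  obtain ⟨n, f, hf⟩ := Module.Finite.exists_fin' (PathAlgebra k Q) M
  have hK : Module.Finite (PathAlgebra k Q) (LinearMap.ker f) :=
    Module.Finite.iff_fg.2 (Module.FinitePresentation.fg_ker f hf)
  have := finite_coker_arrowsMap (k := k) (M := LinearMap.ker f) i
  have hex := LinearMap.exact_subtype_ker_map f
  exact LinearMap.finite_ker_of_exact (arrowsMap_naturality (LinearMap.ker f).subtype i)
    (arrowsMap_naturality f i) (arrowsSpaceMap_exact hex i) (arrowsSpaceMap_surjective hf i)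
    (vertexSpaceMap_exact hex i) (vertexSpaceMap_injective Subtype.val_injective i)
    (arrowsMap_injective (f := LinearMap.id) Function.injective_id i)

theorem index_arrowsMap_eq_add {f : M →ₗ[PathAlgebra k Q] N} {g : N →ₗ[PathAlgebra k Q] L}
    (hf : Function.Injective f) (hfg : Function.Exact f g) (hg : Function.Surjective g)
    [Module.FinitePresentation (PathAlgebra k Q) M] [Module.FinitePresentation (PathAlgebra k Q) N]
    [Module.FinitePresentation (PathAlgebra k Q) L] (i : Q) :
    (arrowsMap k N i).index = (arrowsMap k M i).index + (arrowsMap k L i).index := by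
  have := finite_ker_arrowsMap (k := k) (M := M) i
  have := finite_ker_arrowsMap (k := k) (M := N) i
  have := finite_ker_arrowsMap (k := k) (M := L) i
  have := finite_coker_arrowsMap (k := k) (M := M) i
  have := finite_coker_arrowsMap (k := k) (M := N) i
  have := finite_coker_arrowsMap (k := k) (M := L) i
  exact LinearMap.index_eq_add (arrowsMap_naturality f i) (arrowsMap_naturality g i)
    (arrowsSpaceMap_injective hf i) (arrowsSpaceMap_exact hfg i) (arrowsSpaceMap_surjective hg i)
    (vertexSpaceMap_injective hf i) (vertexSpaceMap_exact hfg i) (vertexSpaceMap_surjective hg i)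

theorem sum_arrowsFrom (i : Q) (F : Q → ℤ) :
    ∑ e : ArrowsFrom i, F e.1 = ∑ j : Q, (Nat.card (i ⟶ j) : ℤ) * F j := by
  have : ∀ j, Fintype (i ⟶ j) := fun j => Fintype.ofFinite _
  rw [show instFintypeArrowsFrom i = Sigma.instFintype from Subsingleton.elim _ _,
    Fintype.sum_sigma]
  simp

theorem index_arrowsMap_of_finite [Module.Finite k M] (i : Q) :
    (arrowsMap k M i).index = (∑ j : Q, (Nat.card (i ⟶ j) : ℤ) *
      Module.finrank k (vertexSpace k M j)) - Module.finrank k (vertexSpace k M i) := by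
  rw [LinearMap.index_eq_of_finiteDimensional, Module.finrank_pi_fintype, Nat.cast_sum,
    sum_arrowsFrom i fun j => (Module.finrank k (vertexSpace k M j) : ℤ)]

/-- Here `M` is a copy of `R p_l`. Fox derivatives preserve `R p_l`, so an element of `p_i R p_l`
with zero augmentation is a sum of arrows times elements of `R p_l`. -/
theorem range_arrowsMap_eq_ker {f : M →ₗ[PathAlgebra k Q] PathAlgebra k Q}
    (hf : Function.Injective f) {l : Q}
    (hrange : ∀ x, x ∈ LinearMap.range f ↔ x * vertex k l = x) (i : Q) :
    LinearMap.range (arrowsMap k M i) =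
      LinearMap.ker (nilCoeff k i ∘ₗ f.restrictScalars k ∘ₗ (vertexSpace k M i).subtype) := by
  ext m
  refine ⟨?_, fun hm => ?_⟩
  · rintro ⟨x, rfl⟩
    rw [LinearMap.mem_ker]
    simp only [LinearMap.comp_apply, Submodule.subtype_apply, LinearMap.restrictScalars_apply,
      coe_arrowsMap, map_sum, map_smul, smul_eq_mul, nilCoeff_mul, nilCoeff_arrow, zero_mul,
      Finset.sum_const_zero]
  · have hm0 : nilCoeff k i (f m) = 0 := hm
    have h1 : ∀ e : ArrowsFrom i, ∃ x, f x = foxDeriv k e.2 (f m) := fun e =>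
      (hrange _).2 (foxDeriv_mul_vertex k e.2 l ((hrange _).1 ⟨_, rfl⟩))
    choose x hx using h1
    refine ⟨fun e => ⟨x e, hf ?_⟩, Subtype.ext (hf ?_)⟩
    · rw [map_smul, hx, smul_eq_mul, vertex_mul_foxDeriv]
    · rw [coe_arrowsMap, map_sum]
      simp only [map_smul, hx, smul_eq_mul]
      conv_rhs => rw [← (mem_vertexSpace k M).1 m.2, map_smul, smul_eq_mul, vertex_mul_eq, hm0,
        zero_smul, zero_add]

-- The map is injective, and its cokernel is the image of `ε_i` on `p_i R p_l`: all of `k` if `i =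
-- l`, zero otherwise.
open Classical in
theorem index_arrowsMap_of_range_eq {f : M →ₗ[PathAlgebra k Q] PathAlgebra k Q}
    (hf : Function.Injective f) {l : Q}
    (hrange : ∀ x, x ∈ LinearMap.range f ↔ x * vertex k l = x) (i : Q) :
    (arrowsMap k M i).index = -(if i = l then 1 else 0) := by
  have hf' : Function.Injective (LinearMap.pi fun _ : Unit => f) :=
    fun x y h => hf (congrFun h ())
  rw [LinearMap.index_of_injective (arrowsMap_injective hf' i), range_arrowsMap_eq_ker hf hrange,
    (LinearMap.quotKerEquivRange _).finrank_eq]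
  congr 1
  split_ifs with h
  · subst h
    obtain ⟨m, hm⟩ := (hrange (vertex k i)).2 (vertex_mul_vertex k i)
    have hmem : m ∈ vertexSpace k M i := hf (by rw [map_smul, hm, smul_eq_mul, vertex_mul_vertex])
    rw [LinearMap.range_eq_top.2, finrank_top, Module.finrank_self, Nat.cast_one]
    intro c
    refine ⟨c • ⟨m, hmem⟩, ?_⟩
    rw [map_smul]
    simp [hm, nilCoeff_vertex_self]
  · rw [LinearMap.range_eq_bot.2, finrank_bot, Nat.cast_zero]
    refine LinearMap.ext fun m => ?_
    change nilCoeff k i (f m) = 0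
    rw [← (hrange _).1 ⟨m, rfl⟩, nilCoeff_mul, nilCoeff_vertex_of_ne k (Ne.symm h), mul_zero]

end VertexSpace

end PathAlgebra

/-! ### Characteristic polynomials in short exact sequences. -/

namespace LinearMap

variable {k A B C : Type*} [Field k] [AddCommGroup A] [Module k A] [AddCommGroup B] [Module k B]
  [AddCommGroup C] [Module k C] [Module.Finite k B]

open Module.Basis in
-- In a basis adapted to the invariant subspace `W` the matrix is block triangular.
theorem charpoly_eq_charpoly_restrict_mul_charpoly_mapQ (W : Submodule k B) (e : B →ₗ[k] B)
    (he : W ≤ W.comap e) : e.charpoly = (e.restrict he).charpoly * (W.mapQ W e he).charpoly := by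
  let bW := Module.Free.chooseBasis k W
  let bQ := Module.Free.chooseBasis k (B ⧸ W)
  let b := sumQuot bW bQ
  have h : LinearMap.toMatrix b b e = Matrix.fromBlocks (LinearMap.toMatrix bW bW (e.restrict he))
      (Matrix.of fun i l => b.repr (e (b (Sum.inr l))) (Sum.inl i)) 0
      (LinearMap.toMatrix bQ bQ (W.mapQ W e he)) := by
    ext u v
    rcases u with i | j <;> rcases v with m | l
    · simp only [b, sumQuot_inl, Matrix.fromBlocks_apply₁₁, LinearMap.toMatrix_apply]
      apply sumQuot_repr_inl_of_mem
    · simp [b, LinearMap.toMatrix_apply, Matrix.fromBlocks_apply₁₂]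
    · suffices W.mkQ (e (bW m)) = 0 by simp [b, LinearMap.toMatrix_apply, this]
      rw [← LinearMap.mem_ker, Submodule.ker_mkQ]
      exact he (Submodule.coe_mem (bW m))
    · simp only [LinearMap.toMatrix_apply, sumQuot_repr_inr, Matrix.fromBlocks_apply₂₂, b]
      rw [← sumQuot_inr bW bQ l, W.mapQ_apply]
      simp
  rw [← LinearMap.charpoly_toMatrix e b, h, Matrix.charpoly_fromBlocks_zero₂₁,
    LinearMap.charpoly_toMatrix, LinearMap.charpoly_toMatrix]

theorem charpoly_eq_mul_of_exact [Module.Finite k A] [Module.Finite k C] {f : A →ₗ[k] B}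
    {g : B →ₗ[k] C} (hf : Function.Injective f) (hfg : Function.Exact f g)
    (hg : Function.Surjective g) {a : A →ₗ[k] A} {b : B →ₗ[k] B} {c : C →ₗ[k] C}
    (hab : f ∘ₗ a = b ∘ₗ f) (hbc : g ∘ₗ b = c ∘ₗ g) : b.charpoly = a.charpoly * c.charpoly := by
  have he : range f ≤ (range f).comap b := by
    rintro _ ⟨x, rfl⟩
    exact ⟨a x, LinearMap.congr_fun hab x⟩
  have hker : ker g = range f := hfg.linearMap_ker_eq
  let e₁ := LinearEquiv.ofInjective f hf
  let e₃ : (B ⧸ range f) ≃ₗ[k] C :=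
    (Submodule.quotEquivOfEq _ _ hker.symm).trans (g.quotKerEquivOfSurjective hg)
  rw [charpoly_eq_charpoly_restrict_mul_charpoly_mapQ (range f) b he, ← e₁.charpoly_conj a,
    ← e₃.charpoly_conj]
  congr 2
  · refine LinearMap.ext fun x => ?_
    obtain ⟨x, rfl⟩ := e₁.surjective x
    rw [LinearEquiv.conj_apply_apply, LinearEquiv.symm_apply_apply]
    exact Subtype.ext (LinearMap.congr_fun hab x).symm
  · refine LinearMap.ext fun x => ?_
    obtain ⟨x, rfl⟩ := e₃.surjective x
    rw [LinearEquiv.conj_apply_apply, LinearEquiv.symm_apply_apply]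
    obtain ⟨x, rfl⟩ := Submodule.mkQ_surjective _ x
    exact LinearMap.congr_fun hbc x

end LinearMap

/-! ### Separating simple modules by the density theorem. -/

section Density

variable {R : Type*} [Ring R] {ι : Type*} [Fintype ι] {S : ι → Type*} [∀ i, AddCommGroup (S i)]
  [∀ i, Module R (S i)] [∀ i, IsSimpleModule R (S i)]

/-- By Schur's lemma no nonzero maps link `S i₀` to the other factors. So the projection to `S i₀`
commutes with every endomorphism, as the density theorem demands. -/
theorem single_apply_eq [DecidableEq ι] {i₀ : ι} (h : ∀ i, i ≠ i₀ → IsEmpty (S i ≃ₗ[R] S i₀))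
    (g : Module.End R (∀ i, S i)) (m : ∀ i, S i) :
    (Pi.single i₀ (g m i₀) : ∀ i, S i) = g (Pi.single i₀ (m i₀)) := by
  have h1 : ∀ i, i ≠ i₀ → ∀ f : S i →ₗ[R] S i₀, f = 0 := fun i hi f =>
    f.bijective_or_eq_zero.resolve_left fun hf => (h i hi).false (LinearEquiv.ofBijective f hf)
  have h2 : ∀ i, i ≠ i₀ → ∀ f : S i₀ →ₗ[R] S i, f = 0 := fun i hi f =>
    f.bijective_or_eq_zero.resolve_left fun hf =>
      (h i hi).false (LinearEquiv.ofBijective f hf).symm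
  ext i
  by_cases hi : i = i₀
  · subst hi
    rw [Pi.single_eq_same]
    conv_lhs => rw [← Finset.univ_sum_single m, map_sum, Finset.sum_apply]
    refine Finset.sum_eq_single i (fun j _ hj => ?_) (by simp)
    exact LinearMap.congr_fun (h1 j hj (LinearMap.proj i ∘ₗ g ∘ₗ LinearMap.single R S j)) (m j)
  · rw [Pi.single_eq_of_ne hi]
    exact (LinearMap.congr_fun (h2 i hi (LinearMap.proj i ∘ₗ g ∘ₗ LinearMap.single R S i₀))
      (m i₀)).symm

theorem exists_smul_eq_self_and_smul_eq_zero {i₀ : ι}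
    (h : ∀ i, i ≠ i₀ → IsEmpty (S i ≃ₗ[R] S i₀)) (s : Finset (∀ i, S i)) :
    ∃ r : R, ∀ m ∈ s, r • m i₀ = m i₀ ∧ ∀ i, i ≠ i₀ → r • m i = 0 := by
  classical
  let f : Module.End (Module.End R (∀ i, S i)) (∀ i, S i) :=
    { toFun := fun m => Pi.single i₀ (m i₀)
      map_add' := fun x y => by rw [Pi.add_apply, Pi.single_add]
      map_smul' := fun g m => by
        exact single_apply_eq h g m }
  obtain ⟨r, hr⟩ := jacobson_density f s
  refine ⟨r, fun m hm => ⟨?_, fun i hi => ?_⟩⟩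
  · have := congrFun (hr m hm) i₀
    simpa [f] using this.symm
  · have := congrFun (hr m hm) i
    simpa [f, hi] using this.symm

/-- Density controls `r` on finite sets only; a finite spanning set over `k` suffices. -/
theorem exists_forall_smul_eq_self_and_smul_eq_zero (k : Type*) [Field k] [Algebra k R]
    [∀ i, Module k (S i)] [∀ i, IsScalarTower k R (S i)] [∀ i, Module.Finite k (S i)] {i₀ : ι}
    (h : ∀ i, i ≠ i₀ → IsEmpty (S i ≃ₗ[R] S i₀)) :
    ∃ r : R, (∀ m : S i₀, r • m = m) ∧ ∀ i, i ≠ i₀ → ∀ m : S i, r • m = 0 := by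
  classical
  obtain ⟨s, hs⟩ := (Module.finite_def (R := k) (M := ∀ i, S i)).1 inferInstance
  obtain ⟨r, hr⟩ := exists_smul_eq_self_and_smul_eq_zero h s
  have key : ∀ m : ∀ i, S i, r • m i₀ = m i₀ ∧ ∀ i, i ≠ i₀ → r • m i = 0 := by
    intro m
    have hm : m ∈ Submodule.span k (s : Set (∀ i, S i)) := hs ▸ Submodule.mem_top
    induction hm using Submodule.span_induction with
    | mem m hm => exact hr m hm
    | zero => exact ⟨smul_zero r, fun i _ => smul_zero r⟩
    | add x y _ _ hx hy =>
      refine ⟨?_, fun i hi => ?_⟩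
      · rw [Pi.add_apply, smul_add, hx.1, hy.1]
      · rw [Pi.add_apply, smul_add, hx.2 i hi, hy.2 i hi, add_zero]
    | smul c x _ hx =>
      refine ⟨?_, fun i hi => ?_⟩
      · rw [Pi.smul_apply, smul_comm, hx.1]
      · rw [Pi.smul_apply, smul_comm, hx.2 i hi, smul_zero]
  refine ⟨r, fun m => ?_, fun i hi m => ?_⟩
  · simpa using (key (Pi.single i₀ m)).1
  · simpa using (key (Pi.single i m)).2 i hi

end Density

/-! ### Simple modules as a basis of `K_0` of the finite-dimensional modules. -/

section FiniteDimensional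

open scoped ModuleCat

variable {k : Type v} [Field k] {R : Type u} [Ring R] [Algebra k R]

theorem finite_of_finDimModules {M : ModuleCat.{u} R} (h : finDimModules k R M) :
    Module.Finite k M := h

theorem finDimModules_of_injective {A B : ModuleCat.{u} R} (f : A →ₗ[R] B)
    (hf : Function.Injective f) (h : finDimModules k R B) : finDimModules k R A := by
  have := finite_of_finDimModules h
  exact Module.Finite.of_injective (f.restrictScalars k) hf

theorem finDimModules_of_surjective {A B : ModuleCat.{u} R} (f : A →ₗ[R] B)
    (hf : Function.Surjective f) (h : finDimModules k R A) : finDimModules k R B := by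
  have := finite_of_finDimModules h
  exact Module.Finite.of_surjective (f.restrictScalars k) hf

theorem finDimModules_punit : finDimModules k R (ModuleCat.of R PUnit.{u + 1}) := by
  have : Subsingleton (ModuleCat.of R PUnit.{u + 1}) := inferInstanceAs (Subsingleton PUnit)
  exact (inferInstance : Module.Finite k (ModuleCat.of R PUnit.{u + 1}))

theorem isFiniteLength_of_finDimModules {M : ModuleCat.{u} R} (h : finDimModules k R M) :
    IsFiniteLength R M := by
  have := finite_of_finDimModules h
  exact isFiniteLength_iff_isNoetherian_isArtinian.2
    ⟨isNoetherian_of_tower k inferInstance, isArtinian_of_tower k inferInstance⟩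

/-- The multiplicity of the eigenvalue `1` of the action of `r` on a finite-dimensional module. -/
def eigenMultiplicity (k : Type v) [Field k] [Algebra k R] (r : R) (M : ModuleCat.{u} R) : ℤ :=
  haveI := Classical.propDecidable (finDimModules k R M)
  if h : finDimModules k R M then
    haveI := finite_of_finDimModules h
    ((Algebra.lsmul k k (M) r).charpoly.rootMultiplicity 1 : ℤ)
  else 0

theorem eigenMultiplicity_eq (r : R) {M : ModuleCat.{u} R} (h : finDimModules k R M) :
    haveI := finite_of_finDimModules h
    eigenMultiplicity k r M =
      ((Algebra.lsmul k k (M) r).charpoly.rootMultiplicity 1 : ℤ) :=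
  dif_pos h

theorem eigenMultiplicity_eq_add (r : R) (S : ShortComplex (ModuleCat.{u} R)) (hS : S.ShortExact)
    (h₁ : finDimModules k R S.X₁) (h₂ : finDimModules k R S.X₂) (h₃ : finDimModules k R S.X₃) :
    eigenMultiplicity k r S.X₂ = eigenMultiplicity k r S.X₁ + eigenMultiplicity k r S.X₃ := by
  have := finite_of_finDimModules h₁
  have := finite_of_finDimModules h₂
  have := finite_of_finDimModules h₃
  rw [eigenMultiplicity_eq r h₁, eigenMultiplicity_eq r h₂, eigenMultiplicity_eq r h₃,
    ← Nat.cast_add]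
  congr 1
  have hfg : Function.Exact S.f.hom S.g.hom :=
    (ShortComplex.ShortExact.moduleCat_exact_iff_function_exact S).1
    hS.exact
  rw [LinearMap.charpoly_eq_mul_of_exact (f := S.f.hom.restrictScalars k)
    (g := S.g.hom.restrictScalars k)
    (a := Algebra.lsmul k k _ r) (b := Algebra.lsmul k k _ r) (c := Algebra.lsmul k k _ r)
    hS.moduleCat_injective_f hfg hS.moduleCat_surjective_g
    (LinearMap.ext fun x => S.f.hom.map_smul r x) (LinearMap.ext fun x => S.g.hom.map_smul r x),
    Polynomial.rootMultiplicity_mul]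
  exact mul_ne_zero (LinearMap.charpoly_monic _).ne_zero (LinearMap.charpoly_monic _).ne_zero

theorem eigenMultiplicity_of_smul_eq_self {r : R} {M : ModuleCat.{u} R}
    (h : finDimModules k R M) (hr : ∀ m : M, r • m = m) :
    eigenMultiplicity k r M = Module.finrank k (M) := by
  have := finite_of_finDimModules h
  have h1 : Algebra.lsmul k k (M) r = 1 := LinearMap.ext hr
  rw [eigenMultiplicity_eq r h, h1, LinearMap.charpoly_one, ← Polynomial.C_1,
    Polynomial.rootMultiplicity_X_sub_C_pow]

theorem eigenMultiplicity_of_smul_eq_zero {r : R} {M : ModuleCat.{u} R}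
    (h : finDimModules k R M) (hr : ∀ m : M, r • m = 0) : eigenMultiplicity k r M = 0 := by
  have := finite_of_finDimModules h
  have h1 : Algebra.lsmul k k (M) r = 0 := LinearMap.ext hr
  rw [eigenMultiplicity_eq r h, h1, LinearMap.charpoly_zero, Nat.cast_eq_zero]
  exact Polynomial.rootMultiplicity_eq_zero (by simp)

variable (k R) in
/-- The class in `K_0` of an isomorphism class of simple modules. -/
def simpleClass (c : IsoClasses (simpleFinDimModules k R)) : K0 (finDimModules k R) :=
  Quotient.lift (fun X : (simpleFinDimModules k R).FullSubcategory =>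
    (K0.of X.obj X.property.2 : K0 (finDimModules k R))) (by
      rintro X Y ⟨e⟩
      exact K0.of_congr ((simpleFinDimModules k R).ι.mapIso e).toLinearEquiv X.property.2
        Y.property.2 finDimModules_punit) c

theorem simpleClass_mk (S : ModuleCat.{u} R) (hS : simpleFinDimModules k R S) :
    simpleClass k R (IsoClasses.mk S hS) = K0.of S hS.2 := rfl

/-- Induction along a composition series. -/
theorem of_mem_span_simpleClass {M : Type u} [AddCommGroup M] [Module R M]
    (hM : finDimModules k R (ModuleCat.of R M)) :
    (K0.of _ hM : K0 (finDimModules k R)) ∈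
      Submodule.span ℤ (Set.range (simpleClass k R)) := by
  have hlen : IsFiniteLength R M := isFiniteLength_of_finDimModules hM
  induction hlen with
  | of_subsingleton =>
    rw [K0.of_subsingleton]
    exact zero_mem _
  | @of_simple_quotient M _ _ N _ _ ih =>
    have hN := finDimModules_of_injective (A := ModuleCat.of R N) (B := ModuleCat.of R M)
      N.subtype Subtype.val_injective hM
    have hQ := finDimModules_of_surjective (A := ModuleCat.of R M)
      (B := ModuleCat.of R (M ⧸ N)) N.mkQ N.mkQ_surjective hM
    rw [K0.of_exact N.subtype N.mkQ Subtype.val_injective (LinearMap.exact_subtype_mkQ N)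
      N.mkQ_surjective hN hM hQ]
    exact add_mem (ih hN) (Submodule.subset_span
      ⟨IsoClasses.mk (ModuleCat.of R (M ⧸ N)) ⟨‹_›, hQ⟩, rfl⟩)

/-- With `r` the identity on one simple module and zero on the others, `eigenMultiplicity` returns
the coefficient of that module times its dimension. A trace would determine this only modulo the
characteristic of `k`; the multiplicity is an integer. -/
theorem linearIndependent_simpleClass : LinearIndependent ℤ (simpleClass k R) := by
  classical
  rw [linearIndependent_iff']
  intro s n hn c₀ hc₀
  let X : s → (simpleFinDimModules k R).FullSubcategory := fun c => Quotient.out c.1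
  have hX : ∀ c : s, simpleClass k R c = K0.of (X c).obj (X c).property.2 := fun c => by
    conv_lhs => rw [← Quotient.out_eq c.1]
    rfl
  have hsimple : ∀ c : s, IsSimpleModule R (X c).obj := fun c => (X c).property.1
  have hempty : ∀ c : s, c ≠ ⟨c₀, hc₀⟩ → IsEmpty ((X c).obj ≃ₗ[R] (X ⟨c₀, hc₀⟩).obj) := by
    refine fun c hc => ⟨fun e => hc (Subtype.ext ?_)⟩
    exact Quotient.out_equiv_out.1 ⟨(simpleFinDimModules k R).isoMk e.toModuleIso⟩
  have hfin : ∀ c : s, Module.Finite k ((X c).obj) :=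
    fun c => finite_of_finDimModules (X c).property.2
  obtain ⟨r, hr, hr'⟩ := exists_forall_smul_eq_self_and_smul_eq_zero (R := R)
    (S := fun c => (X c).obj) k hempty
  let φ : K0 (finDimModules k R) →+ ℤ :=
    K0.lift (eigenMultiplicity k r) fun S hS h₁ h₂ h₃ => eigenMultiplicity_eq_add r S hS h₁ h₂ h₃
  have h1 : φ (∑ c ∈ s, n c • simpleClass k R c) = 0 := by rw [hn, map_zero]
  rw [← Finset.sum_coe_sort s fun c => n c • simpleClass k R c, map_sum,
    Finset.sum_eq_single ⟨c₀, hc₀⟩] at h1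
  · rw [map_zsmul, hX ⟨c₀, hc₀⟩, K0.lift_of,
      eigenMultiplicity_of_smul_eq_self (X ⟨c₀, hc₀⟩).property.2 hr, smul_eq_mul] at h1
    have : Nontrivial ((X ⟨c₀, hc₀⟩).obj) :=
      IsSimpleModule.nontrivial R (X ⟨c₀, hc₀⟩).obj
    have hpos := Module.finrank_pos (R := k) (M := (X ⟨c₀, hc₀⟩).obj)
    exact (mul_eq_zero.1 h1).resolve_right (Nat.cast_ne_zero.2 hpos.ne')
  · intro c _ hc
    rw [map_zsmul, hX c, K0.lift_of,
      eigenMultiplicity_of_smul_eq_zero (X c).property.2 (hr' c hc), smul_zero]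
  · simp

variable (k R) in
/-- Jordan-Hölder: `K_0` of the finite-dimensional modules is free on the classes of the simple
ones. -/
theorem exists_basis_simpleClass :
    ∃ b : Module.Basis (IsoClasses (simpleFinDimModules k R)) ℤ (K0 (finDimModules k R)),
      ∀ (S : ModuleCat R) (hS : simpleFinDimModules k R S),
        b (IsoClasses.mk S hS) = K0.of S hS.2 := by
  refine ⟨Module.Basis.mk linearIndependent_simpleClass fun x _ => ?_, fun S hS => ?_⟩
  · exact K0.induction (p := (Submodule.span ℤ (Set.range (simpleClass k R))).toAddSubgroup)
      (fun X hX => of_mem_span_simpleClass hX) x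
  · rw [Module.Basis.mk_apply, simpleClass_mk]

end FiniteDimensional

theorem AddSubgroup.exists_eq_sum_of_mem_closure {ι G : Type*} [Fintype ι] [AddCommGroup G]
    {g : ι → G} {x : G} (hx : x ∈ AddSubgroup.closure (Set.range g)) :
    ∃ n : ι → ℤ, ∑ i, n i • g i = x := by
  rw [← Submodule.span_int_eq_addSubgroupClosure] at hx
  exact (Submodule.mem_span_range_iff_exists_fun ℤ).1 hx

/-! ### Finite presentation of finite-dimensional modules. -/

section FiniteType

variable {k : Type*} [Field k] {R : Type*} [Ring R] [Algebra k R]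

/-- Over a finitely generated algebra, finite-dimensional modules are finitely presented. -/
theorem finitePresentation_of_finiteType [Algebra.FiniteType k R] (M : Type*) [AddCommGroup M]
    [Module R M] [Module k M] [IsScalarTower k R M] [Module.Finite k M] :
    Module.FinitePresentation R M := by
  classical
  obtain ⟨s, hs⟩ := Algebra.FiniteType.out (R := k) (A := R)
  let b := Module.finBasis k M
  let f : (Fin (Module.finrank k M) → R) →ₗ[R] M := Fintype.linearCombination R b
  let e : Fin (Module.finrank k M) → Fin (Module.finrank k M) → R := fun c => Pi.single c 1
  have hfe : ∀ c, f (e c) = b c := fun c => by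
    rw [Fintype.linearCombination_apply_single, one_smul]
  -- The relations express the action of each algebra generator on each basis vector of `M`.
  let ρ : s × Fin (Module.finrank k M) → Fin (Module.finrank k M) → R := fun p =>
    (p.1 : R) • e p.2 - ∑ c, b.repr ((p.1 : R) • b p.2) c • e c
  have hfk : ∀ (a : k) x, f (a • x) = a • f x := (f.restrictScalars k).map_smul
  have hρ : ∀ p, f (ρ p) = 0 := fun p => by
    simp only [ρ, map_sub, map_smul, map_sum, hfk, hfe, b.sum_repr, sub_self]
  let K := Submodule.span R (Set.range ρ)
  have hK : K ≤ LinearMap.ker f := by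
    rw [Submodule.span_le]
    rintro _ ⟨p, rfl⟩
    exact hρ p
  -- Modulo `K`, algebra generators map the span of the `e c` to itself. Hence `W` is stable under
  -- `R` and is the whole free module.
  let W : Submodule k (Fin (Module.finrank k M) → R) :=
    K.restrictScalars k ⊔ Submodule.span k (Set.range e)
  have heW : ∀ c, e c ∈ W := fun c => Submodule.mem_sup_right (Submodule.subset_span ⟨c, rfl⟩)
  have hgen : ∀ g ∈ s, ∀ w ∈ W, g • w ∈ W := by
    intro g hg w hw
    obtain ⟨y, hy, z, hz, rfl⟩ := Submodule.mem_sup.1 hw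
    rw [smul_add]
    refine add_mem (Submodule.mem_sup_left (K.smul_mem g hy)) ?_
    clear hw
    induction hz using Submodule.span_induction with
    | mem z h =>
      obtain ⟨c, rfl⟩ := h
      have : g • e c = ρ (⟨g, hg⟩, c) + ∑ c', b.repr (g • b c) c' • e c' := by
        simp only [ρ, sub_add_cancel]
      rw [this]
      exact add_mem (Submodule.mem_sup_left (Submodule.subset_span ⟨_, rfl⟩))
        (sum_mem fun c' _ => Submodule.smul_mem _ _ (heW c'))
    | zero => rw [smul_zero]; exact zero_mem _
    | add x y _ _ hx hy =>
      rw [smul_add]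
      exact add_mem hx hy
    | smul a x _ hx =>
      rw [smul_comm]
      exact Submodule.smul_mem _ _ hx
  have hW : ∀ (r : R), ∀ w ∈ W, r • w ∈ W := by
    intro r
    have hr : r ∈ Algebra.adjoin k (s : Set R) := hs ▸ Algebra.mem_top
    induction hr using Algebra.adjoin_induction with
    | mem g hg => exact hgen g hg
    | algebraMap a =>
      intro w hw
      rw [algebraMap_smul]
      exact W.smul_mem a hw
    | add x y _ _ hx hy =>
      intro w hw
      rw [add_smul]
      exact add_mem (hx w hw) (hy w hw)
    | mul x y _ _ hx hy =>
      intro w hw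
      rw [mul_smul]
      exact hx _ (hy w hw)
  have hker : LinearMap.ker f = K := by
    refine le_antisymm (fun x hx => ?_) hK
    have hxW : x ∈ W := by
      have : x = ∑ c, x c • e c := by
        conv_lhs => rw [← Finset.univ_sum_single x]
        exact Finset.sum_congr rfl fun c _ => by rw [← Pi.single_smul, smul_eq_mul, mul_one]
      rw [this]
      exact sum_mem fun c _ => hW _ _ (heW c)
    obtain ⟨y, hy, z, hz, rfl⟩ := Submodule.mem_sup.1 hxW
    obtain ⟨a, rfl⟩ := (Submodule.mem_span_range_iff_exists_fun k).1 hz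
    have h0 : ∑ c, a c • b c = 0 := by
      rw [LinearMap.mem_ker, map_add, LinearMap.mem_ker.1 (hK hy), zero_add, map_sum] at hx
      simpa only [hfk, hfe] using hx
    -- Every element of `ker f` is thus in `K` up to a scalar combination of the `e c`, which
    -- vanishes because the `e c` map to a basis.
    have ha := Fintype.linearIndependent_iff.1 b.linearIndependent a h0
    simp only [ha, zero_smul, Finset.sum_const_zero, add_zero]
    exact hy
  refine Module.finitePresentation_of_surjective f (fun m => ⟨∑ c, b.repr m c • e c, ?_⟩) ?_
  · simp only [map_sum, hfk, hfe, b.sum_repr]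
  · rw [hker]
    exact Submodule.fg_span (Set.finite_range ρ)

end FiniteType

/-! ### Euler characteristics, the basis `[R p_i]` and the image of the finite-dimensional modules.
-/

namespace PathAlgebra

variable {k : Type u} [Field k] {Q : Type v} [Quiver.{w} Q] [Fintype Q]

section Simple

variable (k)

/-- The augmentation of the path algebra at a vertex. -/
def nilCoeffHom (l : Q) : PathAlgebra k Q →+* k :=
  { nilCoeff k l with
    map_one' := by
      change nilCoeff k l 1 = 1
      rw [one_def, map_sum, Finset.sum_eq_single l]
      · exact nilCoeff_vertex_self k l
      · exact fun i _ hi => nilCoeff_vertex_of_ne k hi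
      · simp
    map_mul' := nilCoeff_mul k l
    map_zero' := map_zero (nilCoeff k l) }

/-- The simple module concentrated at the vertex `l`, on which all arrows act by zero. -/
def vertexSimple (l : Q) : ModuleCat.{max u v w} (PathAlgebra k Q) :=
  letI : Module (PathAlgebra k Q) (ULift.{max v w} k) := Module.compHom _ (nilCoeffHom k l)
  ModuleCat.of _ (ULift.{max v w} k)

open scoped ModuleCat

/-- The underlying vector space of the module `vertexSimple k l`. -/
def vertexSimpleEquiv (l : Q) : vertexSimple k l ≃ₗ[k] k :=
  { Equiv.ulift (α := k) with
    map_add' := fun _ _ => rfl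
    map_smul' := fun c x => by
      change nilCoeff k l (algebraMap k (PathAlgebra k Q) c) * ULift.down x = c * ULift.down x
      rw [Algebra.algebraMap_eq_smul_one, map_smul]
      congr 1
      rw [show nilCoeff k l 1 = 1 from map_one (nilCoeffHom k l), smul_eq_mul, mul_one] }

theorem vertexSimpleEquiv_smul (l : Q) (r : PathAlgebra k Q) (x : vertexSimple k l) :
    vertexSimpleEquiv k l (r • x) = nilCoeff k l r * vertexSimpleEquiv k l x := rfl

theorem finDimModules_vertexSimple (l : Q) :
    finDimModules k (PathAlgebra k Q) (vertexSimple k l) :=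
  Module.Finite.equiv (vertexSimpleEquiv k l).symm

open Classical in
theorem finrank_vertexSpace_vertexSimple (l i : Q) :
    Module.finrank k (vertexSpace k (vertexSimple k l) i) = if l = i then 1 else 0 := by
  split_ifs with h
  · subst h
    have : vertexSpace k (vertexSimple k l) l = ⊤ := top_unique fun x _ =>
      (vertexSimpleEquiv k l).injective (by
        rw [vertexSimpleEquiv_smul, nilCoeff_vertex_self, one_mul])
    rw [this, finrank_top, (vertexSimpleEquiv k l).finrank_eq, Module.finrank_self]
  · have : vertexSpace k (vertexSimple k l) i = ⊥ := (Submodule.eq_bot_iff _).2 fun x hx =>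
      (vertexSimpleEquiv k l).injective (by
        rw [← (mem_vertexSpace k _).1 hx, vertexSimpleEquiv_smul,
          nilCoeff_vertex_of_ne k (Ne.symm h), zero_mul, map_zero])
    rw [this, finrank_bot]

end Simple

variable [∀ i j : Q, Finite (i ⟶ j)]

instance instFiniteType : Algebra.FiniteType k (PathAlgebra k Q) := by
  refine ⟨Subalgebra.fg_def.2 ⟨Set.range (vertex k) ∪
    Set.range (fun e : Σ i : Q, ArrowsFrom i => arrow k e.2.2),
    (Set.finite_range _).union (Set.finite_range _), top_unique fun x hx => ?_⟩⟩
  clear hx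
  induction x using PathAlgebra.induction with
  | zero => exact zero_mem _
  | add x y hx hy => exact add_mem hx hy
  | smul c x hx => exact Subalgebra.smul_mem _ hx c
  | path a b p =>
  induction p with
  | nil => exact Algebra.subset_adjoin (Or.inl ⟨a, rfl⟩)
  | @cons b c p e ih =>
    rw [← ofPath_mul_arrow]
    exact mul_mem ih (Algebra.subset_adjoin (Or.inr ⟨⟨b, c, e⟩, rfl⟩))

open scoped ModuleCat

variable (k Q) in
theorem finDimModules_le_fpModules :
    finDimModules k (PathAlgebra k Q) ≤ fpModules (PathAlgebra k Q) := by
  intro M hM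
  have := finite_of_finDimModules hM
  exact finitePresentation_of_finiteType (k := k) M

/-- The class of `R p_i` in `K_0` of the finitely presented modules. -/
def projClass (k : Type u) [Field k] (i : Q) : K0 (fpModules (PathAlgebra k Q)) :=
  K0.of _ (projModules_le_fpModules _ _ (projModules_leftIdeal_vertex (k := k) i))

/-- The Euler characteristic at the vertex `i`, on `K_0` of the finitely presented modules. -/
def eulerChar (k : Type u) [Field k] (i : Q) : K0 (fpModules (PathAlgebra k Q)) →+ ℤ :=
  -- The index is kernel minus cokernel; the sign makes the cokernel count positively.
  K0.lift (fun M => -(arrowsMap k M i).index) fun S hS h₁ h₂ h₃ => by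
    have : Module.FinitePresentation (PathAlgebra k Q) S.X₁ := h₁
    have : Module.FinitePresentation (PathAlgebra k Q) S.X₂ := h₂
    have : Module.FinitePresentation (PathAlgebra k Q) S.X₃ := h₃
    rw [index_arrowsMap_eq_add (k := k) (f := S.f.hom) (g := S.g.hom) hS.moduleCat_injective_f
      ((ShortComplex.ShortExact.moduleCat_exact_iff_function_exact S).1 hS.exact)
      hS.moduleCat_surjective_g i, neg_add]

open Classical in
theorem eulerChar_projClass (i l : Q) :
    eulerChar k i (projClass k l) = if i = l then 1 else 0 := by
  refine (K0.lift_of _ _ _ _).trans ?_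
  rw [neg_eq_iff_eq_neg]
  let f : leftIdeal (PathAlgebra k Q) (vertex k l) →ₗ[PathAlgebra k Q] PathAlgebra k Q :=
    (Submodule.span (PathAlgebra k Q) {vertex k l}).subtype
  refine index_arrowsMap_of_range_eq (f := f) Subtype.val_injective (fun x => ?_) i
  rw [← mem_span_vertex_iff]
  exact ⟨fun ⟨y, hy⟩ => hy ▸ y.2, fun hx => ⟨⟨x, hx⟩, rfl⟩⟩

theorem eulerChar_of_finDim {M : ModuleCat (PathAlgebra k Q)}
    (hM : finDimModules k (PathAlgebra k Q) M) (hM' : fpModules (PathAlgebra k Q) M) (i : Q) :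
    eulerChar k i (K0.of M hM') = (Module.finrank k (vertexSpace k M i) : ℤ) -
      ∑ j : Q, (Nat.card (i ⟶ j) : ℤ) * Module.finrank k (vertexSpace k M j) := by
  have := finite_of_finDimModules hM
  refine (K0.lift_of _ _ _ _).trans ?_
  rw [index_arrowsMap_of_finite, neg_sub]

theorem eulerChar_sum (n : Q → ℤ) (i : Q) :
    eulerChar k i (∑ l, n l • projClass k l) = n i := by
  classical
  simp only [map_sum, map_zsmul, eulerChar_projClass, smul_eq_mul, mul_ite, mul_one, mul_zero,
    Finset.sum_ite_eq, Finset.mem_univ, if_true]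

theorem linearIndependent_projClass : LinearIndependent ℤ (projClass (Q := Q) k) :=
  Fintype.linearIndependent_iff.2 fun n hn i => by rw [← eulerChar_sum (k := k) n i, hn, map_zero]

theorem mem_closure_projClass (x : K0 (fpModules (PathAlgebra k Q))) :
    x ∈ AddSubgroup.closure (Set.range (projClass (Q := Q) k)) :=
  K0.induction (fun M hM => of_mem_closure (projModules_le_fpModules _) M hM hM) x

theorem sum_eulerChar (x : K0 (fpModules (PathAlgebra k Q))) :
    ∑ i, eulerChar k i x • projClass k i = x := by
  obtain ⟨n, rfl⟩ := AddSubgroup.exists_eq_sum_of_mem_closure (mem_closure_projClass x)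
  simp only [eulerChar_sum]

/-- The generators `[R p_i]` of `K_0(R)` map to a basis of the target, so no relation between them
is killed. -/
theorem bijective_map_projModules :
    Function.Bijective (K0.map (projModules_le_fpModules (PathAlgebra k Q))) := by
  constructor
  · rw [injective_iff_map_eq_zero]
    intro x hx
    have h : x ∈ AddSubgroup.closure (Set.range fun i : Q =>
        (K0.of _ (projModules_leftIdeal_vertex i) : K0 (projModules (PathAlgebra k Q)))) :=
      K0.induction (fun M hM => of_mem_closure le_rfl M hM (projModules_le_fpModules _ _ hM)) x
    obtain ⟨n, rfl⟩ := AddSubgroup.exists_eq_sum_of_mem_closure h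
    simp only [map_sum, map_zsmul, K0.map_of] at hx
    have hn := Fintype.linearIndependent_iff.1 (linearIndependent_projClass (k := k)) n hx
    simp only [hn, zero_smul, Finset.sum_const_zero]
  · intro x
    rw [← sum_eulerChar x]
    refine ⟨∑ i, eulerChar k i x • K0.of _ (projModules_leftIdeal_vertex i), ?_⟩
    simp only [map_sum, map_zsmul, K0.map_of]
    rfl

variable (k Q) in
/-- The classes `[R p_i]` form a basis of `K_0` of the finitely presented modules. -/
def projClassBasis : Module.Basis Q ℤ (K0 (fpModules (PathAlgebra k Q))) :=
  Module.Basis.mk linearIndependent_projClass fun x _ => by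
    rw [← sum_eulerChar x]
    exact sum_mem fun i _ => Submodule.smul_mem _ _ (Submodule.subset_span ⟨i, rfl⟩)

theorem projClassBasis_apply (i : Q) : projClassBasis k Q i = projClass k i :=
  Module.Basis.mk_apply _ _ _

-- The coordinates of the class are its Euler characteristics; exchanging the sums groups them by
-- the dimensions of the vertex spaces.
open Classical in
theorem of_finDim_eq_sum {M : ModuleCat (PathAlgebra k Q)}
    (hM : finDimModules k (PathAlgebra k Q) M) (hM' : fpModules (PathAlgebra k Q) M) :
    (K0.of M hM' : K0 (fpModules (PathAlgebra k Q))) =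
      ∑ l : Q, (Module.finrank k (vertexSpace k M l) : ℤ) •
        ∑ j : Q, ((if j = l then 1 else 0) - (Nat.card (j ⟶ l) : ℤ)) • projClass k j := by
  rw [← sum_eulerChar (K0.of M hM')]
  simp only [Finset.smul_sum, smul_smul]
  rw [Finset.sum_comm]
  refine Finset.sum_congr rfl fun j _ => ?_
  rw [← Finset.sum_smul, eulerChar_of_finDim hM]
  congr 1
  simp only [mul_sub, mul_ite, mul_one, mul_zero, Finset.sum_sub_distrib, Finset.sum_ite_eq,
    Finset.mem_univ, if_true, mul_comm (Nat.card _ : ℤ)]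

-- The expansion in columns gives one inclusion. For the other, `vertexSimple k l` has a single
-- nonzero vertex space, of dimension one, so its class is the `l`-th column.
open Classical in
theorem range_map_finDim (h : finDimModules k (PathAlgebra k Q) ≤ fpModules (PathAlgebra k Q)) :
    (K0.map h).range = AddSubgroup.closure (Set.range fun l : Q =>
      ∑ j : Q, ((if j = l then 1 else 0) - (Nat.card (j ⟶ l) : ℤ)) • projClass k j) := by
  refine le_antisymm ?_ ((AddSubgroup.closure_le _).2 ?_)
  · rintro _ ⟨x, rfl⟩
    rw [← AddSubgroup.mem_comap]
    refine K0.induction (fun M hM => ?_) x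
    rw [AddSubgroup.mem_comap, K0.map_of, of_finDim_eq_sum hM]
    exact sum_mem fun l _ => zsmul_mem (AddSubgroup.subset_closure (Set.mem_range_self l)) _
  · rintro _ ⟨l, rfl⟩
    refine ⟨K0.of _ (finDimModules_vertexSimple k l), ?_⟩
    rw [K0.map_of, of_finDim_eq_sum (finDimModules_vertexSimple k l), Finset.sum_eq_single l]
    · rw [finrank_vertexSpace_vertexSimple, if_pos rfl, Nat.cast_one, one_smul]
    · intro i _ hi
      rw [finrank_vertexSpace_vertexSimple, if_neg (Ne.symm hi), Nat.cast_zero, zero_smul]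
    · simp

end PathAlgebra

end

/-! ### Specialization to the inverse quiver. -/

theorem proposition5p2 (k : Type u) [Field k] (V : Type v) [Fintype V] [DecidableEq V]
    [Quiver.{w} V] [∀ i j : V, Finite (i ⟶ j)] :
    -- `K_0` of the finite-dimensional modules is free on the isomorphism classes of the simple ones
    (∃ b : Module.Basis (IsoClasses (simpleFinDimModules k (InversePathAlgebra k V))) ℤ
        (K0 (finDimModules k (InversePathAlgebra k V))),
      ∀ (S : ModuleCat (InversePathAlgebra k V))
        (hS : simpleFinDimModules k (InversePathAlgebra k V) S),
        b (IsoClasses.mk S hS) = K0.of S hS.2) ∧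
    -- the canonical map `K_0(R) → K_0(fp R)` is an isomorphism
    Function.Bijective (K0.map (projModules_le_fpModules (InversePathAlgebra k V))) ∧
    -- `K_0(fp R)` is free on the classes of the modules `R p_i`
    (∃ b : Module.Basis V ℤ (K0 (fpModules (InversePathAlgebra k V))),
      ∀ i : V, b i = vertexClass k i) ∧
    -- finite-dimensional modules are finitely presented, and the image of the induced map on
    -- `K_0` is generated by the columns of `1 - A_E ^ t`
    (∃ h : finDimModules k (InversePathAlgebra k V) ≤ fpModules (InversePathAlgebra k V),
      (K0.map h).range = AddSubgroup.closure (Set.range fun i : V =>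
        ∑ j : V, (1 - (adjacencyMatrix V).transpose) j i • vertexClass k j)) := by
  have hfin : ∀ i j : Vᵒᵖ, Finite (i ⟶ j) := fun i j =>
    Finite.of_equiv (j.unop ⟶ i.unop) Opposite.equivToOpposite
  refine ⟨exists_basis_simpleClass k _, PathAlgebra.bijective_map_projModules,
    ⟨(PathAlgebra.projClassBasis k Vᵒᵖ).reindex Opposite.equivToOpposite.symm, fun i => ?_⟩,
    PathAlgebra.finDimModules_le_fpModules k Vᵒᵖ, ?_⟩
  · rw [Module.Basis.reindex_apply, PathAlgebra.projClassBasis_apply]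
    rfl
  · classical
    rw [PathAlgebra.range_map_finDim, ← Opposite.equivToOpposite.surjective.range_comp]
    congr 2
    funext i
    refine Fintype.sum_equiv Opposite.equivToOpposite.symm _ _ fun j => ?_
    -- Reversing the arrows transposes the adjacency matrix, which accounts for the transpose of
    -- `A_E`.
    have hcard : Nat.card (j ⟶ Opposite.op i) = Nat.card (i ⟶ j.unop) :=
      Nat.card_congr Opposite.equivToOpposite.symm
    change ((if j = Opposite.op i then 1 else 0) - (Nat.card (j ⟶ Opposite.op i) : ℤ)) •
        PathAlgebra.projClass k j =
      ((1 : Matrix V V ℤ) j.unop i - (Nat.card (i ⟶ j.unop) : ℤ)) • PathAlgebra.projClass k j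
    rw [hcard, Matrix.one_apply]
    simp only [← Opposite.unop_inj_iff]
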